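/- Let $\mathscr{R}\in L^\infty(\mathbb{R})$ be $1$-periodic and bounded below by a positive constant (almost everywhere). For every $\lambda>0$ there is a unique pair $(c,h)=(c(\lambda),h(\cdot,\lambda))\in\mathbb{R}\times W^{1,\infty}(\mathbb{R})$ such that $$-c+\mathscr{R}(z)\sqrt{1+h(z)^2}=\lambda\,\frac{h_z(z)}{1+h(z)^2},\qquad h(z)=h(z+1)\qquad\text{for almost every } z\in\mathbb{R},\qquad \int_0^1 h(t)\,dt=0,$$ where $h_z$ denotes the weak derivative of $h$. The function $\lambda\mapsto c(\lambda)$ defined in this way is $C^\infty$ and nonincreasing on $(0,+\infty)$, and $$\lim_{\lambda\downarrow 0}c(\lambda)=\operatorname*{ess\,sup}_{z\in\mathbb{R}}\mathscr{R}(z),\qquad \lim_{\lambda\to+\infty}c(\lambda)=\int_0^1\mathscr{R}(z)\,dz.$$ More precisely, $c'(\lambda)<0$ for all $\lambda>0$ as soon as $\mathscr{R}$ is not almost everywhere equal to a constant. -/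

import Mathlib

open MeasureTheory Filter Topology
open scoped ContDiff ENNReal

/-- `g` is the weak (distributional) derivative of `h` on `ℝ`. -/
def IsWeakDeriv (h g : ℝ → ℝ) : Prop :=
  ∀ φ : ℝ → ℝ, ContDiff ℝ ∞ φ → HasCompactSupport φ →
    ∫ z, h z * deriv φ z = -∫ z, g z * φ z

/-- The class of `f` modulo a.e. equality is `1`-periodic. -/
def AEPeriodicOne (f : ℝ → ℝ) : Prop :=
  ∀ᵐ z : ℝ, f (z + 1) = f z

/-- `𝓡 ∈ L^∞(ℝ)` is `1`-periodic and bounded below by a positive constant. -/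
structure IsCombustionRate (𝓡 : ℝ → ℝ) : Prop where
  memLp : MemLp 𝓡 ∞ volume
  periodic : AEPeriodicOne 𝓡
  lower_bound : ∃ m : ℝ, 0 < m ∧ ∀ᵐ z : ℝ, m ≤ 𝓡 z

/-- `(c, h) ∈ ℝ × W^{1,∞}(ℝ)` solves, with weak derivative `h_z ∈ L^∞(ℝ)`,
`-c + 𝓡 √(1 + h²) = lam * h_z / (1 + h²)` a.e., with `h` `1`-periodic and of zero mean. -/
structure IsFrontSolution (𝓡 : ℝ → ℝ) (lam c : ℝ) (h : ℝ → ℝ) : Prop where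
  memLp : MemLp h ∞ volume
  weak_eq : ∃ hz : ℝ → ℝ, MemLp hz ∞ volume ∧ IsWeakDeriv h hz ∧
    ∀ᵐ z : ℝ, -c + 𝓡 z * Real.sqrt (1 + h z ^ 2) = lam * (hz z / (1 + h z ^ 2))
  periodic : AEPeriodicOne h
  mean_zero : ∫ z in (0 : ℝ)..1, h z = 0

/-! Put `μ = 1 / lam` and `σ = h / (μ √(1 + h²))`. The front equation becomes `σ' = R - c √(1 - μ²
σ²)`, and the zero mean of `h` becomes that of `σ / √(1 - μ² σ²)`. This problem is regular at `μ =
0`, where it is linear, so large `lam` is a neighbourhood of `μ = 0`, and the whole statement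
follows from a study of `μ ↦ c`.

Uniqueness is a comparison argument: the difference of two profiles satisfies `D' ≤ β D`, so it has
a constant sign on a period (`forall_nonneg_or_forall_neg`), and the zero mean forces it to vanish.
Comparison with constants gives bounds uniform in `μ`: `m ≤ c ≤ M`, `|σ| ≤ M`, `|σ'| ≤ M`, and `1 -
μ² σ²` bounded away from `0`.

Existence is a continuity method on `μ ∈ ℝ`. The set of good `μ` contains `0`, is closed by the
bounds and Arzelà–Ascoli, and is open by the implicit function theorem applied to the polynomial map
`frontMap`; its linearization is a scalar periodic linear equation, solved by variation of
constants. The same theorem and uniqueness make the speed smooth in `μ`.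

Differentiating the equation in `μ` and integrating over a period against `exp (-∫ β)`, where `β`
has mean zero by the constraint on `σ`, gives `c'(μ) W = ∫ exp (-∫ β) c μ σ² / √(1 - μ² σ²)` with `W
> 0`: this yields monotonicity, strict unless `σ = 0`, that is, unless `R` is constant. Finally `|σ|
< lam`, so if all speeds are at most `L` then every integral of `R - L` over an interval is at most
`2 lam`, whence `R ≤ L` a.e.; this identifies the limit at `lam = 0`. -/

/-! ### Weak derivatives and Lipschitz representatives -/

/-- A locally integrable function with vanishing weak derivative is a.e. constant. -/
theorem ae_eq_const_of_integral_mul_deriv_eq_zero {f : ℝ → ℝ} (hf : LocallyIntegrable f)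
    (h : ∀ φ : ℝ → ℝ, ContDiff ℝ ∞ φ → HasCompactSupport φ → ∫ z, f z * deriv φ z = 0) :
    ∃ C : ℝ, ∀ᵐ z, f z = C := by
  let b : ContDiffBump (0 : ℝ) := default
  set ρ : ℝ → ℝ := b.normed volume with hρ
  have hρs : ContDiff ℝ ∞ ρ := b.contDiff_normed
  have hρc : HasCompactSupport ρ := b.hasCompactSupport_normed
  have hρi : ∫ x, ρ x = 1 := b.integral_normed
  refine ⟨∫ z, f z * ρ z, ?_⟩
  refine ae_eq_of_integral_contDiff_smul_eq hf (locallyIntegrable_const _) fun ψ hψ hψc => ?_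
  set I := ∫ x, ψ x with hI
  have hψint : Integrable ψ := hψ.continuous.integrable_of_hasCompactSupport hψc
  have hρint : Integrable ρ := hρs.continuous.integrable_of_hasCompactSupport hρc
  -- Removing the mean of `ψ` along a fixed bump makes the primitive of `ζ` compactly supported,
  -- hence an admissible test function; this is also why the constant is `∫ f ρ`.
  set ζ : ℝ → ℝ := fun x => ψ x - I * ρ x with hζ
  have hζs : ContDiff ℝ ∞ ζ := hψ.sub (contDiff_const.mul hρs)
  have hζc : HasCompactSupport ζ := hψc.sub (hρc.mul_left (f := fun _ => I))
  have hζi : ∫ x, ζ x = 0 := by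
    rw [hζ, integral_sub hψint (hρint.const_mul I), integral_const_mul, hρi, mul_one, sub_self]
  obtain ⟨N₀, hN₀⟩ := hζc.isCompact.isBounded.subset_closedBall (0 : ℝ)
  set N := |N₀| + 1 with hN
  have hNpos : 0 < N := by positivity
  have hζ0 : ∀ x, x ∉ Set.Ioo (-N) N → ζ x = 0 := by
    intro x hx
    by_contra hne
    have := hN₀ (subset_tsupport ζ hne)
    rw [mem_closedBall_zero_iff, Real.norm_eq_abs, abs_le] at this
    apply hx
    constructor <;> linarith [this.1, this.2, le_abs_self N₀]
  set φ : ℝ → ℝ := fun z => ∫ t in (-N)..z, ζ t with hφ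
  have hφd : ∀ z, HasDerivAt φ (ζ z) z := fun z =>
    intervalIntegral.integral_hasDerivAt_right (hζs.continuous.intervalIntegrable _ _)
      hζs.continuous.stronglyMeasurable.stronglyMeasurableAtFilter hζs.continuous.continuousAt
  have hφ' : deriv φ = ζ := funext fun z => (hφd z).deriv
  have hφs : ContDiff ℝ ∞ φ := by
    rw [contDiff_infty_iff_deriv]
    exact ⟨fun z => (hφd z).differentiableAt, by rw [hφ']; exact hζs⟩
  have hφc : HasCompactSupport φ := by
    refine HasCompactSupport.of_support_subset_isCompact (isCompact_Icc (a := -N) (b := N)) ?_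
    intro z hz
    by_contra hzN
    apply hz
    rw [Set.mem_Icc, not_and_or, not_le, not_le] at hzN
    rcases hzN with hz1 | hz1
    · have : ∫ t in (-N)..z, ζ t = ∫ t in (-N)..z, (0 : ℝ) := by
        refine intervalIntegral.integral_congr fun t ht => ?_
        rw [Set.uIcc_of_ge hz1.le] at ht
        exact hζ0 t fun h => by linarith [h.1, ht.2]
      simpa [hφ] using this
    · change ∫ t in (-N)..z, ζ t = 0
      rw [intervalIntegral.integral_eq_integral_of_support_subset, hζi]
      intro t ht
      have : t ∈ Set.Ioo (-N) N := by
        by_contra hne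
        exact ht (hζ0 t hne)
      exact ⟨this.1, by linarith [this.2]⟩
  have key := h φ hφs hφc
  rw [hφ'] at key
  have hfψ : Integrable fun z => ψ z * f z :=
    hf.integrable_smul_left_of_hasCompactSupport hψ.continuous hψc
  have hfρ : Integrable fun z => ρ z * f z :=
    hf.integrable_smul_left_of_hasCompactSupport hρs.continuous hρc
  have e : ∫ z, f z * ζ z = (∫ z, ψ z * f z) - I * ∫ z, ρ z * f z := by
    rw [← integral_const_mul, ← integral_sub hfψ (hfρ.const_mul I)]
    refine integral_congr_ae (Eventually.of_forall fun z => ?_)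
    simp only [hζ]; ring
  simp only [smul_eq_mul]
  rw [integral_mul_const, ← hI]
  rw [e] at key
  have e2 : ∫ z, f z * ρ z = ∫ z, ρ z * f z := by simp_rw [mul_comm]
  rw [e2]; linarith

/-- Lipschitz functions are absolutely continuous, so one integrates by parts on an interval with
the support of `φ` in its interior; the boundary terms vanish. -/
theorem LipschitzWith.isWeakDeriv {h g : ℝ → ℝ} {K : NNReal} (hh : LipschitzWith K h)
    (hg : ∀ᵐ z, deriv h z = g z) : IsWeakDeriv h g := by
  intro φ hφ hφc
  obtain ⟨N, hN⟩ := hφc.isCompact.isBounded.subset_closedBall (0 : ℝ)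
  set N' := |N| + 1 with hN'
  have hmem : ∀ x ∈ tsupport φ, x ∈ Set.Ioo (-N') N' := by
    intro x hm
    have := hN hm
    rw [mem_closedBall_zero_iff, Real.norm_eq_abs, abs_le] at this
    constructor <;> linarith [this.1, this.2, le_abs_self N]
  have hac : AbsolutelyContinuousOnInterval h (-N') N' :=
    hh.lipschitzOnWith.absolutelyContinuousOnInterval
  have hacφ : AbsolutelyContinuousOnInterval φ (-N') N' :=
    ((hφ.of_le (by simp)).contDiffOn).absolutelyContinuousOnInterval
  have e1 : φ N' = 0 := image_eq_zero_of_notMem_tsupport fun hm => (hmem _ hm).2.false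
  have e2 : φ (-N') = 0 := image_eq_zero_of_notMem_tsupport fun hm => (hmem _ hm).1.false
  have key := hac.integral_mul_deriv_eq_deriv_mul hacφ
  rw [e1, e2, intervalIntegral.integral_eq_integral_of_support_subset,
    intervalIntegral.integral_eq_integral_of_support_subset] at key
  · rw [key, mul_zero, mul_zero, sub_zero, zero_sub]
    congr 1
    refine integral_congr_ae ?_
    filter_upwards [hg] with z hz
    rw [hz]
  · intro x hx
    exact Set.Ioo_subset_Ioc_self (hmem x (subset_tsupport φ (right_ne_zero_of_mul hx)))
  · intro x hx
    exact Set.Ioo_subset_Ioc_self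
      (hmem x (tsupport_deriv_subset (subset_tsupport _ (right_ne_zero_of_mul hx))))

/-- A bounded function with bounded weak derivative has a Lipschitz representative. -/
theorem IsWeakDeriv.exists_lipschitz {h g : ℝ → ℝ} (hh : MemLp h ∞ volume) (hg : MemLp g ∞ volume)
    (hw : IsWeakDeriv h g) :
    ∃ (H : ℝ → ℝ) (K : NNReal), LipschitzWith K H ∧ h =ᵐ[volume] H ∧
      ∀ᵐ z, HasDerivAt H (g z) z := by
  have hgl : LocallyIntegrable g := hg.locallyIntegrable (by simp)
  have hhl : LocallyIntegrable h := hh.locallyIntegrable (by simp)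
  have hgi : ∀ a b, IntervalIntegrable g volume a b := fun a b =>
    (hgl.integrableOn_isCompact isCompact_uIcc).intervalIntegrable
  obtain ⟨K, hK⟩ : ∃ K : NNReal, ∀ᵐ z, ‖g z‖ ≤ K := by
    refine ⟨(eLpNorm g ∞ volume).toNNReal, ?_⟩
    filter_upwards [ae_le_eLpNormEssSup (f := g) (μ := volume)] with z hz
    rw [← eLpNorm_exponent_top] at hz
    have := ENNReal.toReal_mono hg.eLpNorm_ne_top hz
    simpa [ENNReal.coe_toNNReal_eq_toReal] using this
  set G : ℝ → ℝ := fun z => ∫ t in (0 : ℝ)..z, g t with hG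
  have hGl : LipschitzWith K G := by
    refine LipschitzWith.of_dist_le_mul fun x y => ?_
    rw [dist_eq_norm, hG, intervalIntegral.integral_interval_sub_left (hgi _ _) (hgi _ _),
      Real.dist_eq]
    refine intervalIntegral.norm_integral_le_of_norm_le_const_ae ?_
    filter_upwards [hK] with z hz _ using hz
  have hGd : ∀ᵐ z, HasDerivAt G (g z) z := by
    filter_upwards [_root_.LocallyIntegrable.ae_hasDerivAt_integral hgl] with z hz using hz 0
  have hGw : IsWeakDeriv G g := hGl.isWeakDeriv (hGd.mono fun z hz => hz.deriv)
  have hGloc : LocallyIntegrable G := hGl.continuous.locallyIntegrable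
  obtain ⟨C, hC⟩ := ae_eq_const_of_integral_mul_deriv_eq_zero (f := fun z => h z - G z)
    (hhl.sub hGloc) fun φ hφ hφc => by
      have hc' : Continuous (deriv φ) := hφ.continuous_deriv (by simp)
      have i1 : Integrable fun z => h z * deriv φ z := by
        simpa [mul_comm] using hhl.integrable_smul_left_of_hasCompactSupport hc' hφc.deriv
      have i2 : Integrable fun z => G z * deriv φ z := by
        simpa [mul_comm] using hGloc.integrable_smul_left_of_hasCompactSupport hc' hφc.deriv
      simp_rw [sub_mul]
      rw [integral_sub i1 i2, hw φ hφ hφc, hGw φ hφ hφc, sub_self]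
  refine ⟨fun z => C + G z, K, ?_, ?_, ?_⟩
  · exact LipschitzWith.of_dist_le_mul fun x y => by simpa using hGl.dist_le_mul x y
  · filter_upwards [hC] with z hz
    linarith
  · filter_upwards [hGd] with z hz using hz.const_add C

/-! ### Bounded rates and comparison on one period -/

/-- `R` is measurable with values in `[m, M]`, where `m > 0`. -/
structure IsRate (R : ℝ → ℝ) (m M : ℝ) : Prop where
  measurable : Measurable R
  pos : 0 < m
  ge : ∀ z, m ≤ R z
  le : ∀ z, R z ≤ M

namespace IsRate
variable {R : ℝ → ℝ} {m M : ℝ}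

theorem intervalIntegrable (hR : IsRate R m M) (a b : ℝ) : IntervalIntegrable R volume a b := by
  have hc : IntervalIntegrable (fun _ : ℝ => M) volume a b := intervalIntegrable_const
  refine hc.mono_fun hR.measurable.aestronglyMeasurable (Eventually.of_forall fun z => ?_)
  have h1 := hR.ge z
  have h2 := hR.le z
  have h3 := hR.pos
  simp only [Real.norm_eq_abs]
  rw [abs_of_nonneg (by linarith), abs_of_nonneg (by linarith)]
  exact h2

end IsRate

/-- A continuous nonnegative function on `[0, 1]` with zero integral vanishes. -/
theorem eq_zero_of_integral_eq_zero {f : ℝ → ℝ} (hf : ContinuousOn f (Set.Icc 0 1))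
    (h0 : ∀ z ∈ Set.Icc (0 : ℝ) 1, 0 ≤ f z) (hi : ∫ t in (0 : ℝ)..1, f t = 0) :
    ∀ z ∈ Set.Icc (0 : ℝ) 1, f z = 0 := by
  intro z hz
  by_contra hne
  have := intervalIntegral.integral_pos one_pos hf (fun x hx => h0 x (Set.Ioc_subset_Icc_self hx))
    ⟨z, hz, lt_of_le_of_ne (h0 z hz) (Ne.symm hne)⟩
  exact this.ne' hi

theorem not_forall_pos_of_integral_eq_zero {f : ℝ → ℝ} (hf : ContinuousOn f (Set.Icc 0 1))
    (hi : ∫ t in (0 : ℝ)..1, f t = 0) : ¬ ∀ z ∈ Set.Icc (0 : ℝ) 1, 0 < f z := fun h =>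
  (h 0 (by simp)).ne' (eq_zero_of_integral_eq_zero hf (fun z hz => (h z hz).le) hi 0 (by simp))

theorem not_forall_neg_of_integral_eq_zero {f : ℝ → ℝ} (hf : ContinuousOn f (Set.Icc 0 1))
    (hi : ∫ t in (0 : ℝ)..1, f t = 0) : ¬ ∀ z ∈ Set.Icc (0 : ℝ) 1, f z < 0 := fun h =>
  not_forall_pos_of_integral_eq_zero (f := fun t => -f t) hf.neg
    (by rw [intervalIntegral.integral_neg, hi, neg_zero]) fun z hz => neg_pos.2 (h z hz)

theorem Continuous.hasDerivAt_integral {f : ℝ → ℝ} (hf : Continuous f) (a z : ℝ) :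
    HasDerivAt (fun x => ∫ t in a..x, f t) (f z) z :=
  intervalIntegral.integral_hasDerivAt_right (hf.intervalIntegrable _ _)
    hf.stronglyMeasurable.stronglyMeasurableAtFilter hf.continuousAt

/-- A periodic function on `[0, 1]` satisfying `D' ≤ β D` has a constant sign. -/
theorem forall_nonneg_or_forall_neg {D F β : ℝ → ℝ} (hF : IntervalIntegrable F volume 0 1)
    (hβ : Continuous β) (hD : ∀ z ∈ Set.Icc (0 : ℝ) 1, D z = D 1 + ∫ t in (0 : ℝ)..z, F t)
    (hle : ∀ z ∈ Set.Icc (0 : ℝ) 1, F z ≤ β z * D z) :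
    (∀ z ∈ Set.Icc (0 : ℝ) 1, 0 ≤ D z) ∨ ∀ z ∈ Set.Icc (0 : ℝ) 1, D z < 0 := by
  set G : ℝ → ℝ := fun z => D 1 + ∫ t in (0 : ℝ)..z, F t with hG
  -- Integrating factor: `D E` is nonincreasing. Since `D 0 = D 1`, a nonnegative end value
  -- propagates backwards from `1` and a negative one forwards from `0`.
  set E : ℝ → ℝ := fun z => Real.exp (-∫ t in (0 : ℝ)..z, β t) with hE
  have hEd : ∀ z, HasDerivAt E (-(β z) * E z) z := fun z => by
    have := (hβ.hasDerivAt_integral 0 z).neg.exp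
    rwa [mul_comm] at this
  have hE1 : ContDiff ℝ 1 E := by
    rw [contDiff_one_iff_deriv]
    refine ⟨fun z => (hEd z).differentiableAt, ?_⟩
    have : deriv E = fun z => -(β z) * E z := funext fun z => (hEd z).deriv
    rw [this]
    exact hβ.neg.mul (continuous_iff_continuousAt.2 fun z => (hEd z).continuousAt)
  have hGac : AbsolutelyContinuousOnInterval G 0 1 := by
    have h1 : AbsolutelyContinuousOnInterval (fun _ : ℝ => D 1) 0 1 :=
      (contDiff_const (n := 1)).contDiffOn.absolutelyContinuousOnInterval
    exact h1.add (hF.absolutelyContinuousOnInterval_intervalIntegral (by simp))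
  have hEac : AbsolutelyContinuousOnInterval E 0 1 :=
    hE1.contDiffOn.absolutelyContinuousOnInterval
  have hGd := hF.ae_hasDerivAt_integral
  have mono : ∀ a b, 0 ≤ a → a ≤ b → b ≤ 1 → D b * E b ≤ D a * E a := by
    intro a b ha hab hb
    have hsub : Set.uIcc a b ⊆ Set.uIcc 0 1 := by
      rw [Set.uIcc_of_le hab, Set.uIcc_of_le zero_le_one]
      exact Set.Icc_subset_Icc ha hb
    have key := (hGac.mono hsub).integral_deriv_mul_eq_sub (hEac.mono hsub)
    have hneg : ∫ x in a..b, deriv G x * E x + G x * deriv E x ≤ 0 := by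
      rw [intervalIntegral.integral_of_le hab]
      refine setIntegral_nonpos_ae measurableSet_Ioc ?_
      filter_upwards [hGd] with x hx hxab
      have hx01 : x ∈ Set.Icc (0 : ℝ) 1 := ⟨ha.trans hxab.1.le, hxab.2.trans hb⟩
      have h1 : deriv G x = F x := by
        refine HasDerivAt.deriv ?_
        exact (hx (by rwa [Set.uIcc_of_le zero_le_one]) 0 (by simp)).const_add _
      have h2 : G x = D x := (hD x hx01).symm
      rw [h1, h2, (hEd x).deriv]
      have h3 := hle x hx01
      have h4 : 0 < E x := Real.exp_pos _
      nlinarith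
    have hGb : G b = D b := (hD b ⟨ha.trans hab, hb⟩).symm
    have hGa : G a = D a := (hD a ⟨ha, hab.trans hb⟩).symm
    rw [key, hGb, hGa] at hneg
    linarith
  have hD01 : D 0 = D 1 := by simpa using hD 0 (by simp)
  have hE0 : E 0 = 1 := by simp [hE]
  have hEpos : ∀ z, 0 < E z := fun z => Real.exp_pos _
  rcases le_or_gt 0 (D 1) with h | h
  · left
    intro z hz
    have := mono z 1 hz.1 hz.2 le_rfl
    exact nonneg_of_mul_nonneg_left ((mul_nonneg h (hEpos 1).le).trans this) (hEpos z)
  · right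
    intro z hz
    have := mono 0 z le_rfl hz.1 hz.2
    rw [hE0, mul_one, hD01] at this
    by_contra hc
    exact absurd (mul_nonneg (not_lt.1 hc) (hEpos z).le) (by linarith)

/-! ### Profiles: a priori bounds and uniqueness -/

/-- In the variable `σ = h / (μ √(1 + h²))`, `μ = 1 / lam`, the front equation reads
`σ' = R - c √(1 - μ² σ²)`; this is its integrated form on one period. -/
structure IsProfile (R : ℝ → ℝ) (μ c : ℝ) (σ : ℝ → ℝ) : Prop where
  continuous : Continuous σ
  pos : ∀ z, 0 < 1 - μ ^ 2 * σ z ^ 2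
  eqn : ∀ z ∈ Set.Icc (0 : ℝ) 1,
    σ z = σ 1 + ∫ t in (0 : ℝ)..z, (R t - c * √(1 - μ ^ 2 * σ t ^ 2))
  mean : ∫ t in (0 : ℝ)..1, σ t / √(1 - μ ^ 2 * σ t ^ 2) = 0

namespace IsProfile
variable {R : ℝ → ℝ} {m M μ c : ℝ} {σ : ℝ → ℝ}

theorem sqrt_pos (h : IsProfile R μ c σ) (z : ℝ) : 0 < √(1 - μ ^ 2 * σ z ^ 2) :=
  Real.sqrt_pos.2 (h.pos z)

theorem sqrt_le_one (μ s : ℝ) : √(1 - μ ^ 2 * s ^ 2) ≤ 1 := by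
  rw [Real.sqrt_le_one]
  nlinarith [mul_nonneg (sq_nonneg μ) (sq_nonneg s)]

theorem continuous_sqrt (h : IsProfile R μ c σ) :
    Continuous fun t => √(1 - μ ^ 2 * σ t ^ 2) := by
  have := h.continuous
  fun_prop

theorem continuous_slope (h : IsProfile R μ c σ) :
    Continuous fun t => σ t / √(1 - μ ^ 2 * σ t ^ 2) :=
  h.continuous.div h.continuous_sqrt fun z => (h.sqrt_pos z).ne'

theorem intervalIntegrable (h : IsProfile R μ c σ) (hR : IsRate R m M) (a b : ℝ) :
    IntervalIntegrable (fun t => R t - c * √(1 - μ ^ 2 * σ t ^ 2)) volume a b :=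
  (hR.intervalIntegrable a b).sub ((h.continuous_sqrt.const_mul c).intervalIntegrable a b)

theorem apply_zero (h : IsProfile R μ c σ) : σ 0 = σ 1 := by
  simpa using h.eqn 0 (by simp)

theorem not_forall_pos (h : IsProfile R μ c σ) : ¬ ∀ z ∈ Set.Icc (0 : ℝ) 1, 0 < σ z := fun hp =>
  not_forall_pos_of_integral_eq_zero h.continuous_slope.continuousOn h.mean
    fun z hz => div_pos (hp z hz) (h.sqrt_pos z)

theorem not_forall_neg (h : IsProfile R μ c σ) : ¬ ∀ z ∈ Set.Icc (0 : ℝ) 1, σ z < 0 := fun hp =>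
  not_forall_neg_of_integral_eq_zero h.continuous_slope.continuousOn h.mean
    fun z hz => div_neg_of_neg_of_pos (hp z hz) (h.sqrt_pos z)

/-- The equation at `z = 1` expresses periodicity; it determines the speed once the profile is
known. -/
theorem mul_integral_sqrt (h : IsProfile R μ c σ) (hR : IsRate R m M) :
    c * ∫ t in (0 : ℝ)..1, √(1 - μ ^ 2 * σ t ^ 2) = ∫ t in (0 : ℝ)..1, R t := by
  have := h.eqn 1 (by simp)
  rw [intervalIntegral.integral_sub (hR.intervalIntegrable 0 1)
    ((h.continuous_sqrt.const_mul c).intervalIntegrable 0 1),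
    intervalIntegral.integral_const_mul] at this
  linarith

theorem integral_sqrt_pos (h : IsProfile R μ c σ) :
    0 < ∫ t in (0 : ℝ)..1, √(1 - μ ^ 2 * σ t ^ 2) :=
  intervalIntegral.intervalIntegral_pos_of_pos (h.continuous_sqrt.intervalIntegrable 0 1)
    h.sqrt_pos one_pos

theorem integral_sqrt_le_one (h : IsProfile R μ c σ) :
    ∫ t in (0 : ℝ)..1, √(1 - μ ^ 2 * σ t ^ 2) ≤ 1 := by
  calc _ ≤ ∫ t in (0 : ℝ)..1, (1 : ℝ) :=
        intervalIntegral.integral_mono_on zero_le_one (h.continuous_sqrt.intervalIntegrable 0 1)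
          intervalIntegrable_const fun t _ => sqrt_le_one μ (σ t)
    _ = 1 := by simp

end IsProfile

theorem IsRate.le_integral {R : ℝ → ℝ} {m M : ℝ} (hR : IsRate R m M) :
    m ≤ ∫ t in (0 : ℝ)..1, R t := by
  calc m = ∫ t in (0 : ℝ)..1, m := by simp
    _ ≤ _ := intervalIntegral.integral_mono_on zero_le_one intervalIntegrable_const
        (hR.intervalIntegrable 0 1) fun t _ => hR.ge t

theorem IsRate.integral_le {R : ℝ → ℝ} {m M : ℝ} (hR : IsRate R m M) :
    ∫ t in (0 : ℝ)..1, R t ≤ M := by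
  calc _ ≤ ∫ t in (0 : ℝ)..1, M := intervalIntegral.integral_mono_on zero_le_one
        (hR.intervalIntegrable 0 1) intervalIntegrable_const fun t _ => hR.le t
    _ = M := by simp

namespace IsProfile
variable {R : ℝ → ℝ} {m M μ c : ℝ} {σ : ℝ → ℝ}

theorem le_speed (h : IsProfile R μ c σ) (hR : IsRate R m M) : m ≤ c := by
  have h1 := h.mul_integral_sqrt hR
  have h2 := h.integral_sqrt_pos
  have h3 := h.integral_sqrt_le_one
  have h4 := hR.le_integral
  have h5 := hR.pos
  have hc : 0 < c := by
    by_contra hc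
    nlinarith
  nlinarith

/-- The difference of `√(1 - μ² s²)` between two points, as a multiple of the difference. -/
theorem sqrt_sub_sqrt {μ s a : ℝ} (hs : 0 < 1 - μ ^ 2 * s ^ 2) (ha : 0 < 1 - μ ^ 2 * a ^ 2) :
    √(1 - μ ^ 2 * s ^ 2) - √(1 - μ ^ 2 * a ^ 2) =
      -(μ ^ 2 * (s + a) / (√(1 - μ ^ 2 * s ^ 2) + √(1 - μ ^ 2 * a ^ 2))) * (s - a) := by
  have h1 := Real.sqrt_pos.2 hs
  have h2 := Real.sqrt_pos.2 ha
  have e1 := Real.sq_sqrt hs.le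
  have e2 := Real.sq_sqrt ha.le
  field_simp
  linear_combination e1 - e2

theorem continuous_coeff {τ : ℝ → ℝ} {c' : ℝ} (h : IsProfile R μ c σ) (hτ : Continuous τ)
    (hτp : ∀ z, 0 < 1 - μ ^ 2 * τ z ^ 2) :
    Continuous fun t => c' * (μ ^ 2 * (σ t + τ t) /
      (√(1 - μ ^ 2 * σ t ^ 2) + √(1 - μ ^ 2 * τ t ^ 2))) := by
  have := h.continuous
  refine continuous_const.mul (Continuous.div (by fun_prop) (by fun_prop) fun z => ?_)
  exact (add_pos (h.sqrt_pos z) (Real.sqrt_pos.2 (hτp z))).ne'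

/-- The constant `a` is a supersolution, so `D = σ - a` satisfies `D' ≤ β D` and the profile cannot
cross the level `a`. -/
theorem forall_ge_or_forall_lt (h : IsProfile R μ c σ) (hR : IsRate R m M) {a : ℝ}
    (ha : 0 < 1 - μ ^ 2 * a ^ 2) (hca : ∀ t, R t ≤ c * √(1 - μ ^ 2 * a ^ 2)) :
    (∀ z ∈ Set.Icc (0 : ℝ) 1, a ≤ σ z) ∨ ∀ z ∈ Set.Icc (0 : ℝ) 1, σ z < a := by
  have := forall_nonneg_or_forall_neg (D := fun z => σ z - a) (h.intervalIntegrable hR 0 1)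
    (h.continuous_coeff (c' := c) (τ := fun _ => a) continuous_const fun _ => ha)
    (fun z hz => by rw [h.eqn z hz]; ring) fun z _ => by
      have e := sqrt_sub_sqrt (h.pos z) ha
      have := hca z
      linear_combination this - c * e
  simpa using this

/-- Mirror case: `a` is a subsolution, and the comparison applies to `a - σ`. -/
theorem forall_le_or_forall_gt (h : IsProfile R μ c σ) (hR : IsRate R m M) {a : ℝ}
    (ha : 0 < 1 - μ ^ 2 * a ^ 2) (hca : ∀ t, c * √(1 - μ ^ 2 * a ^ 2) ≤ R t) :
    (∀ z ∈ Set.Icc (0 : ℝ) 1, σ z ≤ a) ∨ ∀ z ∈ Set.Icc (0 : ℝ) 1, a < σ z := by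
  have := forall_nonneg_or_forall_neg (D := fun z => a - σ z) (h.intervalIntegrable hR 0 1).neg
    (h.continuous_coeff (c' := c) (τ := fun _ => a) continuous_const fun _ => ha)
    (fun z hz => by
      simp only [Pi.neg_apply, intervalIntegral.integral_neg]
      rw [h.eqn z hz]; ring) fun z _ => by
      have e := sqrt_sub_sqrt (h.pos z) ha
      have := hca z
      simp only [Pi.neg_apply]
      linear_combination this + c * e
  simpa using this

/-- If `c > M`, then `0` is a supersolution, so `σ` has a sign; the zero mean forces `σ = 0`, and
then `c = ∫ R ≤ M`. -/
theorem speed_le (h : IsProfile R μ c σ) (hR : IsRate R m M) : c ≤ M := by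
  by_contra hc
  have h0 := h.forall_ge_or_forall_lt hR (a := 0) (by simp) fun t => by
    simpa using (hR.le t).trans (not_le.1 hc).le
  rcases h0 with h0 | h0
  · have h1 := eq_zero_of_integral_eq_zero h.continuous_slope.continuousOn
      (fun z hz => div_nonneg (h0 z hz) (h.sqrt_pos z).le) h.mean
    have h2 : ∫ t in (0 : ℝ)..1, √(1 - μ ^ 2 * σ t ^ 2) = ∫ t in (0 : ℝ)..1, (1 : ℝ) := by
      refine intervalIntegral.integral_congr fun t ht => ?_
      rw [Set.uIcc_of_le zero_le_one] at ht
      have : σ t = 0 := (div_eq_zero_iff.1 (h1 t ht)).resolve_right (h.sqrt_pos t).ne'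
      simp [this]
    have h3 := h.mul_integral_sqrt hR
    rw [h2] at h3
    have h4 := hR.integral_le
    simp at h3
    linarith
  · exact h.not_forall_neg h0

theorem exists_eq_zero (h : IsProfile R μ c σ) : ∃ z ∈ Set.Icc (0 : ℝ) 1, σ z = 0 := by
  have h1 := h.not_forall_neg
  have h2 := h.not_forall_pos
  push Not at h1 h2
  obtain ⟨a, ha, ha'⟩ := h1
  obtain ⟨b, hb, hb'⟩ := h2
  exact isPreconnected_Icc.intermediate_value hb ha h.continuous.continuousOn ⟨hb', ha'⟩

/-- Both `R` and `c √(1 - μ² σ²)` lie in `[0, M]`, so their difference is at most `M` in absolute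
value. -/
theorem dist_le (h : IsProfile R μ c σ) (hR : IsRate R m M) {x y : ℝ}
    (hx : x ∈ Set.Icc (0 : ℝ) 1) (hy : y ∈ Set.Icc (0 : ℝ) 1) : |σ x - σ y| ≤ M * |x - y| := by
  rw [h.eqn x hx, h.eqn y hy, add_sub_add_left_eq_sub,
    intervalIntegral.integral_interval_sub_left (h.intervalIntegrable hR _ _)
      (h.intervalIntegrable hR _ _)]
  rw [← Real.norm_eq_abs]
  refine intervalIntegral.norm_integral_le_of_norm_le_const fun t _ => ?_
  have h1 := hR.le t
  have h2 := hR.ge t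
  have h3 := h.sqrt_pos t
  have h4 := sqrt_le_one μ (σ t)
  have h5 := h.le_speed hR
  have h6 := h.speed_le hR
  have h7 := hR.pos
  rw [Real.norm_eq_abs, _root_.abs_le]
  constructor <;> nlinarith

theorem abs_le (h : IsProfile R μ c σ) (hR : IsRate R m M) {x : ℝ}
    (hx : x ∈ Set.Icc (0 : ℝ) 1) : |σ x| ≤ M := by
  obtain ⟨z, hz, hz0⟩ := h.exists_eq_zero
  have h1 := h.dist_le hR hx hz
  have hM : 0 < M := hR.pos.trans_le ((hR.ge 0).trans (hR.le 0))
  have : |x - z| ≤ 1 := _root_.abs_le.2 ⟨by linarith [hx.1, hz.2], by linarith [hx.2, hz.1]⟩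
  rw [hz0, sub_zero] at h1
  nlinarith

/-- Uniform bound from below of `1 / √(1 + h²)`. -/
theorem le_one_sub (h : IsProfile R μ c σ) (hR : IsRate R m M) {z : ℝ}
    (hz : z ∈ Set.Icc (0 : ℝ) 1) : (m / (M + 1)) ^ 2 ≤ 1 - μ ^ 2 * σ z ^ 2 := by
  have hm := hR.pos
  have hM : m ≤ M := (hR.ge 0).trans (hR.le 0)
  have hc := h.speed_le hR
  set d := m / (M + 1) with hd
  have hd0 : 0 < d := div_pos hm (by linarith)
  have hd1 : d < 1 := by rw [hd, div_lt_one (by linarith)]; linarith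
  rcases eq_or_ne μ 0 with rfl | hμ
  · simp only [ne_eq, OfNat.ofNat_ne_zero, not_false_eq_true, zero_pow, zero_mul, sub_zero]
    nlinarith
  -- The level with `√(1 - μ² a²) = d`. As `c d ≤ M m / (M + 1) ≤ m ≤ R`, both `a` and `-a` are
  -- subsolutions; the `+ 1` ensures `d < 1`, so `a > 0`. A profile crossing neither level but
  -- changing sign stays between them.
  set a := √(1 - d ^ 2) / |μ| with ha
  have ha0 : 0 < a := div_pos (Real.sqrt_pos.2 (by nlinarith)) (abs_pos.2 hμ)
  have hae : 1 - μ ^ 2 * a ^ 2 = d ^ 2 := by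
    rw [ha, div_pow, sq_abs, Real.sq_sqrt (by nlinarith)]
    field_simp
    ring
  have hcd : ∀ t, c * d ≤ R t := fun t => by
    refine le_trans ?_ (hR.ge t)
    rw [hd, mul_div_assoc', div_le_iff₀ (by linarith)]
    nlinarith
  have h1 := h.forall_le_or_forall_gt hR (a := a) (by rw [hae]; positivity) fun t => by
    rw [hae, Real.sqrt_sq hd0.le]; exact hcd t
  have h2 := h.forall_le_or_forall_gt hR (a := -a) (by rw [neg_sq, hae]; positivity) fun t => by
    rw [neg_sq, hae, Real.sqrt_sq hd0.le]; exact hcd t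
  have h1' : σ z ≤ a := by
    rcases h1 with h1 | h1
    · exact h1 z hz
    · exact absurd (fun z hz => ha0.trans (h1 z hz)) h.not_forall_pos
  have h2' : -a ≤ σ z := by
    rcases h2 with h2 | h2
    · exact absurd (fun z hz => (h2 z hz).trans_lt (neg_lt_zero.2 ha0)) h.not_forall_neg
    · exact (h2 z hz).le
  rw [← hae]
  have : σ z ^ 2 ≤ a ^ 2 := sq_le_sq' h2' h1'
  nlinarith [sq_nonneg μ]

/-- Transfers a sign of `σ - τ` to the slopes, the quantities whose means vanish. For `0 ≤ x` the
numerator grows while the denominator does not; oddness covers the rest. -/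
theorem slope_strictMono {μ x y : ℝ} (hx : 0 < 1 - μ ^ 2 * x ^ 2) (hy : 0 < 1 - μ ^ 2 * y ^ 2)
    (hxy : x < y) : x / √(1 - μ ^ 2 * x ^ 2) < y / √(1 - μ ^ 2 * y ^ 2) := by
  have key : ∀ x y : ℝ, 0 < 1 - μ ^ 2 * x ^ 2 → 0 < 1 - μ ^ 2 * y ^ 2 → 0 ≤ x → x < y →
      x / √(1 - μ ^ 2 * x ^ 2) < y / √(1 - μ ^ 2 * y ^ 2) := by
    intro x y hx hy h0 hxy
    have h2 : √(1 - μ ^ 2 * y ^ 2) ≤ √(1 - μ ^ 2 * x ^ 2) := by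
      refine Real.sqrt_le_sqrt ?_
      nlinarith [sq_nonneg μ, mul_nonneg (sq_nonneg μ) (by nlinarith : 0 ≤ y ^ 2 - x ^ 2)]
    exact div_lt_div₀ hxy h2 (h0.trans hxy.le) (Real.sqrt_pos.2 hy)
  rcases le_or_gt 0 x with h0 | h0
  · exact key x y hx hy h0 hxy
  rcases le_or_gt y 0 with h1 | h1
  · have := key (-y) (-x) (by rwa [neg_sq]) (by rwa [neg_sq]) (by linarith) (by linarith)
    rw [neg_sq, neg_sq, neg_div, neg_div] at this
    linarith
  · exact (div_neg_of_neg_of_pos h0 (Real.sqrt_pos.2 hx)).trans (div_pos h1 (Real.sqrt_pos.2 hy))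

/-- For `c' ≤ c` the difference `D = σ - τ` satisfies `D' ≤ β D`, so it has a sign. The difference
of slopes inherits it and has zero integral. -/
theorem eqOn_of_le {c' : ℝ} {τ : ℝ → ℝ} (h : IsProfile R μ c σ) (h' : IsProfile R μ c' τ)
    (hR : IsRate R m M) (hc : c' ≤ c) : ∀ z ∈ Set.Icc (0 : ℝ) 1, σ z = τ z := by
  have hi : ∫ t in (0 : ℝ)..1,
      (σ t / √(1 - μ ^ 2 * σ t ^ 2) - τ t / √(1 - μ ^ 2 * τ t ^ 2)) = 0 := by
    rw [intervalIntegral.integral_sub (h.continuous_slope.intervalIntegrable 0 1)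
      (h'.continuous_slope.intervalIntegrable 0 1), h.mean, h'.mean, sub_zero]
  have hcont := (h.continuous_slope.sub h'.continuous_slope).continuousOn (s := Set.Icc (0 : ℝ) 1)
  have := forall_nonneg_or_forall_neg (D := fun z => σ z - τ z)
    ((h.intervalIntegrable hR 0 1).sub (h'.intervalIntegrable hR 0 1))
    (h.continuous_coeff (c' := c') h'.continuous h'.pos)
    (fun z hz => by
      rw [intervalIntegral.integral_sub (h.intervalIntegrable hR 0 z)
        (h'.intervalIntegrable hR 0 z), h.eqn z hz, h'.eqn z hz]
      ring) fun z _ => by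
      have e := sqrt_sub_sqrt (h.pos z) (h'.pos z)
      have := mul_nonneg (sub_nonneg.2 hc) (h.sqrt_pos z).le
      linear_combination this - c' * e
  rcases this with hs | hs
  · intro z hz
    have h0 := eq_zero_of_integral_eq_zero hcont (fun z hz => by
      rcases (sub_nonneg.1 (hs z hz)).lt_or_eq with hlt | heq
      · exact sub_nonneg.2 (slope_strictMono (h'.pos z) (h.pos z) hlt).le
      · simp [heq]) hi z hz
    rcases (sub_nonneg.1 (hs z hz)).lt_or_eq with hlt | heq
    · exact absurd h0 (sub_pos.2 (slope_strictMono (h'.pos z) (h.pos z) hlt)).ne'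
    · exact heq.symm
  · exact absurd (fun z hz => sub_neg.2
      (slope_strictMono (h.pos z) (h'.pos z) (sub_neg.1 (hs z hz))))
      (not_forall_neg_of_integral_eq_zero hcont hi)

theorem unique {c' : ℝ} {τ : ℝ → ℝ} (h : IsProfile R μ c σ) (h' : IsProfile R μ c' τ)
    (hR : IsRate R m M) : c = c' ∧ ∀ z ∈ Set.Icc (0 : ℝ) 1, σ z = τ z := by
  have he : ∀ z ∈ Set.Icc (0 : ℝ) 1, σ z = τ z := by
    rcases le_total c' c with hc | hc
    · exact h.eqOn_of_le h' hR hc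
    · exact fun z hz => (h'.eqOn_of_le h hR hc z hz).symm
  refine ⟨?_, he⟩
  have h1 := h.mul_integral_sqrt hR
  have h2 := h'.mul_integral_sqrt hR
  have h3 : ∫ t in (0 : ℝ)..1, √(1 - μ ^ 2 * τ t ^ 2) =
      ∫ t in (0 : ℝ)..1, √(1 - μ ^ 2 * σ t ^ 2) := by
    refine intervalIntegral.integral_congr fun t ht => ?_
    rw [Set.uIcc_of_le zero_le_one] at ht
    simp only [he t ht]
  rw [h3, ← h1] at h2
  exact (mul_right_cancel₀ h.integral_sqrt_pos.ne' h2).symm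

theorem congr {τ : ℝ → ℝ} (h : IsProfile R μ c σ) (hτ : Continuous τ)
    (hτp : ∀ z, 0 < 1 - μ ^ 2 * τ z ^ 2) (he : ∀ z ∈ Set.Icc (0 : ℝ) 1, τ z = σ z) :
    IsProfile R μ c τ where
  continuous := hτ
  pos := hτp
  eqn z hz := by
    rw [he z hz, h.eqn z hz, he 1 (by simp), add_right_inj]
    refine intervalIntegral.integral_congr fun t ht => ?_
    rw [Set.uIcc_of_le hz.1] at ht
    simp only [he t ⟨ht.1, ht.2.trans hz.2⟩]
  mean := by
    refine Eq.trans ?_ h.mean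
    refine intervalIntegral.integral_congr fun t ht => ?_
    rw [Set.uIcc_of_le zero_le_one] at ht
    simp only [he t ht]

end IsProfile

/-! ### Continuous functions on `[0, 1]` and the linearized periodic problem -/

/-- Continuous functions on one period. -/
abbrev PeriodMap : Type := C(Set.Icc (0 : ℝ) 1, ℝ)

namespace PeriodMap

/-- The extension of a continuous function on `[0, 1]` by constants. -/
noncomputable def ext (f : PeriodMap) : ℝ → ℝ := Set.IccExtend (zero_le_one' ℝ) f

theorem continuous_ext (f : PeriodMap) : Continuous f.ext := f.continuous.Icc_extend'

theorem ext_apply (f : PeriodMap) {z : ℝ} (hz : z ∈ Set.Icc (0 : ℝ) 1) : f.ext z = f ⟨z, hz⟩ :=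
  Set.IccExtend_of_mem _ _ hz

theorem ext_coe (f : PeriodMap) (z : Set.Icc (0 : ℝ) 1) : f.ext z = f z := f.ext_apply z.2

theorem ext_eq (f : PeriodMap) (t : ℝ) : f.ext t = f (Set.projIcc 0 1 zero_le_one t) := rfl

theorem ext_continuous_uncurry : Continuous fun p : PeriodMap × ℝ => p.1.ext p.2 := by
  have : Continuous fun p : PeriodMap × ℝ => p.1 (Set.projIcc (0 : ℝ) 1 zero_le_one p.2) :=
    continuous_fst.eval (continuous_projIcc.comp continuous_snd)
  exact this

theorem abs_ext_le (f : PeriodMap) (t : ℝ) : |f.ext t| ≤ ‖f‖ := f.norm_coe_le_norm _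

/-- The primitive vanishing at `0`. -/
noncomputable def primitive : PeriodMap →L[ℝ] PeriodMap :=
  LinearMap.mkContinuous
    { toFun := fun f => ⟨fun z => ∫ t in (0 : ℝ)..z, f.ext t,
        (continuous_iff_continuousAt.2 fun z =>
          (f.continuous_ext.hasDerivAt_integral 0 z).continuousAt).comp continuous_subtype_val⟩
      map_add' := fun f g => ContinuousMap.ext fun z =>
        intervalIntegral.integral_add (f.continuous_ext.intervalIntegrable _ _)
          (g.continuous_ext.intervalIntegrable _ _)
      map_smul' := fun c f => ContinuousMap.ext fun z =>
        intervalIntegral.integral_const_mul c f.ext } 1 (fun f => by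
      rw [one_mul, ContinuousMap.norm_le _ (norm_nonneg f)]
      intro z
      have := intervalIntegral.norm_integral_le_of_norm_le_const (a := 0) (b := (z : ℝ))
        (f := f.ext) (C := ‖f‖) fun t _ => f.abs_ext_le t
      refine this.trans ?_
      rw [sub_zero, abs_of_nonneg z.2.1]
      exact mul_le_of_le_one_right (norm_nonneg f) z.2.2)

theorem primitive_apply (f : PeriodMap) (z : Set.Icc (0 : ℝ) 1) :
    primitive f z = ∫ t in (0 : ℝ)..z, f.ext t := rfl

/-- The mean over one period. -/
noncomputable def mean : PeriodMap →L[ℝ] ℝ := (ContinuousMap.evalCLM ℝ 1).comp primitive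

theorem mean_apply (f : PeriodMap) : mean f = ∫ t in (0 : ℝ)..1, f.ext t := rfl

/-- The constant function with value `f 1`. -/
noncomputable def endConst : PeriodMap →L[ℝ] PeriodMap :=
  (ContinuousMap.evalCLM ℝ 1).smulRight (1 : PeriodMap)

theorem endConst_apply (f : PeriodMap) (z : Set.Icc (0 : ℝ) 1) : endConst f z = f 1 := by
  simp [endConst]

theorem mean_pos {f : PeriodMap} (hf : ∀ z, 0 < f z) : 0 < mean f :=
  intervalIntegral.intervalIntegral_pos_of_pos (f.continuous_ext.intervalIntegrable _ _)
    (fun _ => hf _) one_pos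

/-- Existence for the linearized periodic problem with a free constant `γ`. -/
theorem exists_linearized {β w ρ : PeriodMap} (hw : ∀ z, 0 < w z) (hρ : ∀ z, 0 < ρ z)
    (hβ : mean β = 0) (g : PeriodMap) (a : ℝ) :
    ∃ (γ : ℝ) (η : PeriodMap),
      η - endConst η + γ • primitive w - primitive (β * η) = g ∧ mean (η * ρ) = a := by
  set B : ℝ → ℝ := fun z => ∫ t in (0 : ℝ)..z, β.ext t with hB
  have hBd : ∀ z, HasDerivAt B (β.ext z) z := fun z => β.continuous_ext.hasDerivAt_integral 0 z
  have hBc : Continuous B := continuous_iff_continuousAt.2 fun z => (hBd z).continuousAt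
  have hB1 : B 1 = 0 := hβ
  have hB0 : B 0 = 0 := by simp [hB]
  have hgc := g.continuous_ext
  have hwc := w.continuous_ext
  have hβc := β.continuous_ext
  have hρc := ρ.continuous_ext
  set Q := ∫ t in (0 : ℝ)..1, Real.exp (-B t) * (β.ext t * g.ext t) with hQ
  set W := ∫ t in (0 : ℝ)..1, Real.exp (-B t) * w.ext t with hW
  have hW0 : 0 < W := intervalIntegral.intervalIntegral_pos_of_pos
    (Continuous.intervalIntegrable (by fun_prop) _ _)
    (fun t => mul_pos (Real.exp_pos _) (hw _)) one_pos
  -- Variation of constants for `X = η - g`, which is differentiable even when `g` is not: `X' = β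
  -- (X + g) - γ w`. Since `B 1 = 0`, the closing condition `X 0 = X 1 + g 1` does not involve the
  -- initial value and fixes `γ`.
  set γ := (Q + g.ext 1) / W with hγ
  set f : ℝ → ℝ := fun t => Real.exp (-B t) * (β.ext t * g.ext t - γ * w.ext t) with hf
  have hfc : Continuous f := by fun_prop
  set Y : ℝ → ℝ := fun z => ∫ t in (0 : ℝ)..z, f t with hY
  have hYd : ∀ z, HasDerivAt Y (f z) z := fun z => hfc.hasDerivAt_integral 0 z
  have hYc : Continuous Y := continuous_iff_continuousAt.2 fun z => (hYd z).continuousAt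
  have hY0 : Y 0 = 0 := by simp [hY]
  have hY1 : Y 1 = -g.ext 1 := by
    have : Y 1 = Q - γ * W := by
      rw [hY, hQ, hW, ← intervalIntegral.integral_const_mul, ← intervalIntegral.integral_sub
        (Continuous.intervalIntegrable (by fun_prop) _ _)
        (Continuous.intervalIntegrable (by fun_prop) _ _)]
      refine intervalIntegral.integral_congr fun t _ => ?_
      simp only [hf]; ring
    rw [this, hγ, div_mul_cancel₀ _ hW0.ne']; ring
  set S := ∫ t in (0 : ℝ)..1, Real.exp (B t) * ρ.ext t with hS
  have hS0 : 0 < S := intervalIntegral.intervalIntegral_pos_of_pos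
    (Continuous.intervalIntegrable (by fun_prop) _ _)
    (fun t => mul_pos (Real.exp_pos _) (hρ _)) one_pos
  set T := ∫ t in (0 : ℝ)..1, (Real.exp (B t) * Y t + g.ext t) * ρ.ext t with hT
  -- The initial value is still free; the weighted mean fixes it.
  set x := (a - T) / S with hx
  set X : ℝ → ℝ := fun z => Real.exp (B z) * (x + Y z) with hX
  have hXc : Continuous X := by fun_prop
  let η : PeriodMap := ⟨fun z => X z + g z, by fun_prop⟩
  have hη : ∀ z (hz : z ∈ Set.Icc (0 : ℝ) 1), η.ext z = X z + g.ext z := fun z hz => by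
    rw [ext_apply _ hz, ext_apply _ hz]; rfl
  have hη1 : η 1 = x := by
    change X 1 + g 1 = x
    rw [← g.ext_coe 1]
    simp only [hX, Set.Icc.coe_one, hB1, hY1, Real.exp_zero]
    ring
  have hXd : ∀ z, HasDerivAt X (β.ext z * (X z + g.ext z) - γ * w.ext z) z := fun z => by
    have h1 := (hBd z).exp.mul ((hYd z).const_add x)
    convert! h1 using 1
    simp only [hX, hf, Real.exp_neg]
    have := (Real.exp_pos (B z)).ne'
    field_simp
    ring
  refine ⟨γ, η, ?_, ?_⟩
  · ext z
    have e1 : γ * primitive w z - primitive (β * η) z = X 0 - X z := by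
      have h2 := intervalIntegral.integral_eq_sub_of_hasDerivAt (a := 0) (b := (z : ℝ))
        (fun t _ => hXd t) (Continuous.intervalIntegrable (by fun_prop) _ _)
      rw [primitive_apply, primitive_apply, ← intervalIntegral.integral_const_mul,
        ← intervalIntegral.integral_sub ((hwc.const_mul γ).intervalIntegrable _ _)
        ((β * η).continuous_ext.intervalIntegrable _ _), ← neg_sub (X z), ← h2,
        ← intervalIntegral.integral_neg]
      refine intervalIntegral.integral_congr fun t ht => ?_
      rw [Set.uIcc_of_le z.2.1] at ht
      have ht' : t ∈ Set.Icc (0 : ℝ) 1 := ⟨ht.1, ht.2.trans z.2.2⟩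
      have h3 : (β * η).ext t = β.ext t * η.ext t := rfl
      simp only [h3, hη t ht']
      ring
    have e2 : η z = X z + g z := rfl
    have e3 : X 0 = x := by simp only [hX, hB0, hY0, Real.exp_zero]; ring
    simp only [ContinuousMap.sub_apply, ContinuousMap.add_apply, ContinuousMap.smul_apply,
      smul_eq_mul, endConst_apply, hη1, e2]
    linear_combination e1 + e3
  · rw [mean_apply]
    have e1 : ∫ t in (0 : ℝ)..1, (η * ρ).ext t = x * S + T := by
      rw [hS, hT, ← intervalIntegral.integral_const_mul, ← intervalIntegral.integral_add
        (Continuous.intervalIntegrable (by fun_prop) _ _)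
        (Continuous.intervalIntegrable (by fun_prop) _ _)]
      refine intervalIntegral.integral_congr fun t ht => ?_
      rw [Set.uIcc_of_le zero_le_one] at ht
      have h3 : (η * ρ).ext t = η.ext t * ρ.ext t := rfl
      simp only [h3, hη t ht, hX]
      ring
    rw [e1, hx, div_mul_cancel₀ _ hS0.ne']
    ring

/-- Uniqueness for the linearized periodic problem. -/
theorem eq_zero_of_linearized {β w ρ : PeriodMap} (hw : ∀ z, 0 < w z) (hρ : ∀ z, 0 < ρ z)
    {γ : ℝ} {η : PeriodMap} (h : η - endConst η + γ • primitive w - primitive (β * η) = 0)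
    (hm : mean (η * ρ) = 0) : γ = 0 ∧ η = 0 := by
  -- For `γ ≥ 0` one has `η' = β η - γ w ≤ β η`, so `η` has a sign and its weighted mean kills it.
  -- The case `γ ≤ 0` follows by negation.
  have key : ∀ (γ : ℝ) (η : PeriodMap),
      η - endConst η + γ • primitive w - primitive (β * η) = 0 → mean (η * ρ) = 0 → 0 ≤ γ →
      η = 0 := by
    intro γ η h hm hγ
    have hc : ContinuousOn (η * ρ).ext (Set.Icc 0 1) := (η * ρ).continuous_ext.continuousOn
    have := forall_nonneg_or_forall_neg (D := η.ext) (F := (β * η - γ • w).ext)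
      ((β * η - γ • w).continuous_ext.intervalIntegrable 0 1) β.continuous_ext
      (fun z hz => by
        have h1 := DFunLike.congr_fun h ⟨z, hz⟩
        have h2 : ∫ t in (0 : ℝ)..z, (β * η - γ • w).ext t =
            primitive (β * η - γ • w) ⟨z, hz⟩ := rfl
        rw [h2, map_sub, map_smul, ext_apply _ hz, show η.ext 1 = η 1 from η.ext_coe 1]
        simp only [ContinuousMap.sub_apply, ContinuousMap.add_apply, ContinuousMap.smul_apply,
          smul_eq_mul, endConst_apply, ContinuousMap.zero_apply] at h1 ⊢
        linarith) (fun z _ => by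
        have : (β * η - γ • w).ext z = β.ext z * η.ext z - γ * w.ext z := rfl
        rw [this]
        have := mul_nonneg hγ (hw (Set.projIcc 0 1 zero_le_one z)).le
        rw [← ext_eq] at this
        linarith)
    rcases this with hs | hs
    · ext z
      have h0 := eq_zero_of_integral_eq_zero hc
        (fun z hz => mul_nonneg (hs z hz) (hρ _).le) hm z z.2
      rw [ext_coe] at h0
      exact (mul_eq_zero.1 h0).resolve_right (hρ z).ne'
    · exact absurd (fun z hz => mul_neg_of_neg_of_pos (hs z hz) (hρ (Set.projIcc 0 1 zero_le_one z)))
        (not_forall_neg_of_integral_eq_zero hc hm)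
  have hη : η = 0 := by
    rcases le_total 0 γ with hγ | hγ
    · exact key γ η h hm hγ
    · refine neg_eq_zero.1 (key (-γ) (-η) ?_ ?_ (neg_nonneg.2 hγ))
      · rw [map_neg, mul_neg, map_neg, neg_smul, ← neg_eq_zero, ← h]
        abel
      · rw [neg_mul, map_neg, hm, neg_zero]
  refine ⟨?_, hη⟩
  rw [hη] at h
  have h1 := DFunLike.congr_fun h 1
  simp only [map_zero, mul_zero, sub_zero, zero_add, ContinuousMap.smul_apply, smul_eq_mul,
    ContinuousMap.zero_apply] at h1
  exact (mul_eq_zero.1 h1).resolve_right (mean_pos hw).ne'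

end PeriodMap

open PeriodMap

/-! ### The implicit function theorem for profiles -/

/-- The zeros of this polynomial map are the profiles; `k` stands for `1 / √(1 - μ² σ²)` and `P`
for the primitive of the rate. -/
noncomputable def frontMap (P : PeriodMap) (u : ℝ × ℝ × PeriodMap × PeriodMap) :
    PeriodMap × ℝ × PeriodMap :=
  (u.2.2.1 - endConst u.2.2.1 - P +
      u.2.1 • primitive (u.2.2.2 * (1 - u.1 ^ 2 • u.2.2.1 ^ 2)),
    mean (u.2.2.1 * u.2.2.2),
    u.2.2.2 ^ 2 * (1 - u.1 ^ 2 • u.2.2.1 ^ 2) - 1)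

theorem contDiff_frontMap (P : PeriodMap) : ContDiff ℝ ∞ (frontMap P) := by
  unfold frontMap
  fun_prop

/-- Serves twice: along lines with `μ` fixed it computes the partial Fréchet derivative, and along a
branch of zeros it gives the equation for the derivative of the speed. -/
theorem hasDerivAt_frontMap (P : PeriodMap) {μ c : ℝ → ℝ} {σ k : ℝ → PeriodMap} {ν γ : ℝ}
    {η κ : PeriodMap} {t : ℝ} (hμ : HasDerivAt μ ν t) (hc : HasDerivAt c γ t)
    (hσ : HasDerivAt σ η t) (hk : HasDerivAt k κ t) :
    HasDerivAt (fun t => frontMap P (μ t, c t, σ t, k t))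
      (η - endConst η + γ • primitive (k t * (1 - μ t ^ 2 • σ t ^ 2)) +
          c t • primitive (κ * (1 - μ t ^ 2 • σ t ^ 2) -
            k t * ((2 * μ t * ν) • σ t ^ 2 + (2 * μ t ^ 2) • (σ t * η))),
        mean (η * k t + σ t * κ),
        (2 : ℝ) • (k t * κ) * (1 - μ t ^ 2 • σ t ^ 2) -
          k t ^ 2 * ((2 * μ t * ν) • σ t ^ 2 + (2 * μ t ^ 2) • (σ t * η))) t := by
  have hsq : ∀ {f : ℝ → PeriodMap} {g : PeriodMap}, HasDerivAt f g t →
      HasDerivAt (fun t => f t ^ 2) ((2 : ℝ) • (f t * g)) t := fun {f g} hf => by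
    have := hf.mul hf
    simp_rw [sq]
    convert! this using 1
    rw [two_smul, mul_comm g]
  have hx : HasDerivAt (fun t => 1 - μ t ^ 2 • σ t ^ 2)
      (-((2 * μ t * ν) • σ t ^ 2 + (2 * μ t ^ 2) • (σ t * η))) t := by
    have := ((hμ.fun_pow 2).smul (hsq hσ)).const_sub (1 : PeriodMap)
    convert! this using 1
    ext z
    simp
    ring
  have h1 := ((hσ.sub (endConst.hasFDerivAt.comp_hasDerivAt t hσ)).sub_const P).add
    (hc.smul (primitive.hasFDerivAt.comp_hasDerivAt t (hk.mul hx)))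
  have h2 := mean.hasFDerivAt.comp_hasDerivAt t (hσ.mul hk)
  have h3 := ((hsq hk).mul hx).sub_const (1 : PeriodMap)
  convert! h1.prodMk (h2.prodMk h3) using 1
  refine Prod.ext ?_ (Prod.ext rfl ?_)
  · simp only [mul_neg, ← sub_eq_add_neg, Function.comp_apply, Pi.mul_apply]
    abel
  · simp only [mul_neg, ← sub_eq_add_neg]

section Profile
variable {R : ℝ → ℝ} {m M : ℝ}

theorem IsRate.continuous_primitive (hR : IsRate R m M) :
    Continuous fun z : ℝ => ∫ t in (0 : ℝ)..z, R t :=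
  intervalIntegral.continuous_primitive (fun a b => hR.intervalIntegrable a b) 0

/-- The primitive of the rate. -/
noncomputable def IsRate.primitive (hR : IsRate R m M) : PeriodMap :=
  ⟨fun z => ∫ t in (0 : ℝ)..z, R t, hR.continuous_primitive.comp continuous_subtype_val⟩

section Algebra
variable {P : PeriodMap} {μ c : ℝ} {σ k : PeriodMap}

theorem sq_mul_eq_one (h : frontMap P (μ, c, σ, k) = 0) : k ^ 2 * (1 - μ ^ 2 • σ ^ 2) = 1 :=
  sub_eq_zero.1 (congrArg (fun x => x.2.2) h)

theorem mean_mul_eq_zero (h : frontMap P (μ, c, σ, k) = 0) : mean (σ * k) = 0 :=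
  congrArg (fun x => x.2.1) h

theorem mul_pos_of_frontMap_eq_zero (h : frontMap P (μ, c, σ, k) = 0) (hk : ∀ z, 0 < k z)
    (z : Set.Icc (0 : ℝ) 1) : 0 < (k * (1 - μ ^ 2 • σ ^ 2) : PeriodMap) z := by
  have h1 := DFunLike.congr_fun (sq_mul_eq_one h) z
  have h2 : k z * (k * (1 - μ ^ 2 • σ ^ 2) : PeriodMap) z = 1 := by
    rw [← ContinuousMap.mul_apply, ← mul_assoc, ← sq, h1, ContinuousMap.one_apply]
  exact pos_of_mul_pos_right (by rw [h2]; exact one_pos) (hk z).le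

theorem frontMap_apply_smul (P : PeriodMap) (μ c γ : ℝ) (σ k η κ : PeriodMap) :
    fderiv ℝ (frontMap P) (μ, c, σ, k) (0, γ, η, κ) =
      (η - endConst η + γ • primitive (k * (1 - μ ^ 2 • σ ^ 2)) +
          c • primitive (κ * (1 - μ ^ 2 • σ ^ 2) - k * ((2 * μ ^ 2) • (σ * η))),
        mean (η * k + σ * κ),
        (2 : ℝ) • (k * κ) * (1 - μ ^ 2 • σ ^ 2) - k ^ 2 * ((2 * μ ^ 2) • (σ * η))) := by
  have h1 : HasDerivAt (fun t : ℝ => (μ, c + t * γ, σ + t • η, k + t • κ)) (0, γ, η, κ) 0 := by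
    refine (hasDerivAt_const _ _).prodMk (HasDerivAt.prodMk ?_ (HasDerivAt.prodMk ?_ ?_))
    · simpa using ((hasDerivAt_id (0 : ℝ)).mul_const γ).const_add c
    · simpa using ((hasDerivAt_id (0 : ℝ)).smul_const η).const_add σ
    · simpa using ((hasDerivAt_id (0 : ℝ)).smul_const κ).const_add k
  have h2 : HasFDerivAt (frontMap P) (fderiv ℝ (frontMap P) (μ, c, σ, k))
      (μ, c + (0 : ℝ) * γ, σ + (0 : ℝ) • η, k + (0 : ℝ) • κ) := by
    simp only [zero_mul, zero_smul, add_zero]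
    exact ((contDiff_frontMap P).differentiable (by simp)).differentiableAt.hasFDerivAt
  have h3 := h2.comp_hasDerivAt (0 : ℝ) h1
  have h4 := hasDerivAt_frontMap P (hasDerivAt_const (0 : ℝ) μ) (h1.snd.fst) (h1.snd.snd.fst)
    h1.snd.snd.snd
  rw [h3.unique h4]
  simp

/-- As `k² (1 - μ² σ²) = 1`, the third component can be solved algebraically for `κ`. What remains
is the linearized periodic problem with `β = c μ² σ k`, `w = k (1 - μ² σ²)`, `ρ = k³`; the
constraint `mean (σ * k) = 0` is exactly `mean β = 0`. -/
theorem bijective_fderiv_frontMap (h : frontMap P (μ, c, σ, k) = 0) (hk : ∀ z, 0 < k z) :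
    Function.Bijective (fderiv ℝ (frontMap P) (μ, c, σ, k) ∘L
      ContinuousLinearMap.inr ℝ ℝ (ℝ × PeriodMap × PeriodMap)) := by
  set x : PeriodMap := 1 - μ ^ 2 • σ ^ 2 with hx
  have hkx : k ^ 2 * x = 1 := sq_mul_eq_one h
  have hkx' : ∀ z, k z ^ 2 * x z = 1 := fun z => DFunLike.congr_fun hkx z
  have hxz : ∀ z, x z = 1 - μ ^ 2 * σ z ^ 2 := fun z => by simp [hx]
  set β : PeriodMap := (c * μ ^ 2) • (σ * k) with hβ
  have hβ0 : mean β = 0 := by rw [hβ, map_smul, mean_mul_eq_zero h, smul_zero]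
  have hω : ∀ z, 0 < (k * x) z := mul_pos_of_frontMap_eq_zero h hk
  have hρ : ∀ z, 0 < (k ^ 3) z := fun z => by
    rw [ContinuousMap.pow_apply]; exact pow_pos (hk z) 3
  constructor
  · rw [injective_iff_map_eq_zero]
    rintro ⟨γ, η, κ⟩ h0
    simp only [ContinuousLinearMap.comp_apply, ContinuousLinearMap.inr_apply,
      frontMap_apply_smul, ← hx, Prod.mk_eq_zero] at h0
    obtain ⟨h1, h2, h3⟩ := h0
    have hκ : κ = μ ^ 2 • (k ^ 3 * σ * η) := by
      ext z
      have e3 := DFunLike.congr_fun h3 z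
      have := hkx' z
      simp at e3 ⊢
      linear_combination (k z / 2) * e3 - κ z * this
    have e1 : c • (κ * x - k * ((2 * μ ^ 2) • (σ * η))) = -(β * η) := by
      rw [hκ]
      ext z
      have := hkx' z
      simp [hβ]
      linear_combination (c * μ ^ 2 * k z * σ z * η z) * this
    have e2 : η * k + σ * κ = η * k ^ 3 := by
      rw [hκ]
      ext z
      have := hkx' z
      rw [hxz] at this
      simp
      linear_combination (-η z * k z) * this
    rw [← map_smul primitive c, e1, map_neg, ← sub_eq_add_neg] at h1
    rw [e2] at h2
    obtain ⟨rfl, rfl⟩ := eq_zero_of_linearized hω hρ h1 h2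
    simp [hκ]
  · rintro ⟨g, a, e⟩
    obtain ⟨γ, η, h1, h2⟩ := exists_linearized hω hρ hβ0
      (g - (c / 2) • primitive (k * x * e)) (a - (1 / 2 : ℝ) • mean (σ * k * e))
    set κ : PeriodMap := (1 / 2 : ℝ) • (k * e) + μ ^ 2 • (k ^ 3 * σ * η) with hκ
    refine ⟨(γ, η, κ), ?_⟩
    simp only [ContinuousLinearMap.comp_apply, ContinuousLinearMap.inr_apply,
      frontMap_apply_smul, ← hx]
    have e1 : c • (κ * x - k * ((2 * μ ^ 2) • (σ * η))) = (c / 2) • (k * x * e) - β * η := by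
      rw [hκ]
      ext z
      have := hkx' z
      simp [hβ]
      linear_combination (c * μ ^ 2 * k z * σ z * η z) * this
    have e2 : η * k + σ * κ = η * k ^ 3 + (1 / 2 : ℝ) • (σ * k * e) := by
      rw [hκ]
      ext z
      have := hkx' z
      rw [hxz] at this
      simp
      linear_combination (-η z * k z) * this
    refine Prod.ext ?_ (Prod.ext ?_ ?_)
    · simp only
      rw [← map_smul primitive c, e1, map_sub, map_smul]
      rw [eq_sub_iff_add_eq] at h1
      rw [← h1]
      abel
    · simp only
      rw [e2, map_add, h2, map_smul]
      abel
    · simp only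
      ext z
      have := hkx' z
      simp [hκ]
      linear_combination (e z + 2 * μ ^ 2 * k z ^ 2 * σ z * η z) * this

/-- Through each zero of `frontMap` with `k > 0` passes a smooth curve of zeros. -/
theorem exists_branch (h : frontMap P (μ, c, σ, k) = 0) (hk : ∀ z, 0 < k z) :
    ∃ φ : ℝ → ℝ × PeriodMap × PeriodMap, ContDiffAt ℝ ∞ φ μ ∧ φ μ = (c, σ, k) ∧
      ∀ᶠ ν in 𝓝 μ, frontMap P (ν, φ ν) = 0 ∧ ∀ z, 0 < (φ ν).2.2 z := by
  have cd : ContDiffAt ℝ ∞ (frontMap P) (μ, c, σ, k) := (contDiff_frontMap P).contDiffAt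
  have hinv : (fderiv ℝ (frontMap P) (μ, c, σ, k) ∘L
      ContinuousLinearMap.inr ℝ ℝ (ℝ × PeriodMap × PeriodMap)).IsInvertible := by
    obtain ⟨h1, h2⟩ := bijective_fderiv_frontMap h hk
    exact ⟨ContinuousLinearEquiv.ofBijective _ (LinearMap.ker_eq_bot.2 h1)
      (LinearMap.range_eq_top.2 h2), ContinuousLinearEquiv.coe_ofBijective _ _ _⟩
  have hφ := cd.contDiffAt_implicitFunction (by simp) hinv
  have hφ0 := cd.implicitFunction_apply_self (by simp) hinv
  refine ⟨cd.implicitFunction (by simp) hinv, hφ, hφ0, ?_⟩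
  have hcont : ContinuousAt (fun ν => (cd.implicitFunction (by simp) hinv ν).2.2) μ :=
    (continuous_snd.comp continuous_snd).continuousAt.comp hφ.continuousAt
  -- By compactness of `[0, 1]`, positivity of `k` is an open condition, so it persists along the
  -- branch.
  have hopen : {f : PeriodMap | Set.MapsTo f Set.univ (Set.Ioi 0)} ∈
      𝓝 (cd.implicitFunction (by simp) hinv μ).2.2 := by
    refine (ContinuousMap.isOpen_setOfPred_mapsTo isCompact_univ isOpen_Ioi).mem_nhds ?_
    change Set.MapsTo (cd.implicitFunction (by simp) hinv (μ, c, σ, k).1).2.2 _ _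
    rw [hφ0]
    exact fun z _ => hk z
  filter_upwards [cd.eventually_apply_implicitFunction (by simp) hinv,
    hcont.preimage_mem_nhds hopen] with ν h1 h2
  exact ⟨h1.trans h, fun z => h2 (Set.mem_univ z)⟩

end Algebra

/-- Positivity of `k` selects the root `k = 1 / √(1 - μ² σ²)` of the polynomial constraint. -/
theorem sqrt_eq_of_frontMap_eq_zero {P : PeriodMap} {μ c : ℝ} {σ k : PeriodMap}
    (h : frontMap P (μ, c, σ, k) = 0) (hk : ∀ z, 0 < k z) (t : ℝ) :
    √(1 - μ ^ 2 * σ.ext t ^ 2) = (k * (1 - μ ^ 2 • σ ^ 2)).ext t ∧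
      0 < 1 - μ ^ 2 * σ.ext t ^ 2 ∧ σ.ext t / √(1 - μ ^ 2 * σ.ext t ^ 2) = (σ * k).ext t := by
  set z := Set.projIcc (0 : ℝ) 1 zero_le_one t with hz
  have h1 : k z ^ 2 * (1 - μ ^ 2 * σ z ^ 2) = 1 := by
    simpa using DFunLike.congr_fun (sq_mul_eq_one h) z
  have hkz := hk z
  have h2 : 0 < 1 - μ ^ 2 * σ z ^ 2 := pos_of_mul_pos_right (h1 ▸ one_pos) (sq_nonneg _)
  have h3 : (k * (1 - μ ^ 2 • σ ^ 2)).ext t = k z * (1 - μ ^ 2 * σ z ^ 2) := by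
    simp [ext_eq, ← hz]
  have h4 : √(1 - μ ^ 2 * σ z ^ 2) = k z * (1 - μ ^ 2 * σ z ^ 2) := by
    rw [Real.sqrt_eq_iff_mul_self_eq_of_pos (by positivity)]
    linear_combination (1 - μ ^ 2 * σ z ^ 2) * h1
  have h5 : (σ * k).ext t = σ z * k z := rfl
  simp only [h3, h5]
  simp only [ext_eq, ← hz]
  refine ⟨h4, h2, ?_⟩
  rw [h4, div_eq_iff (by positivity)]
  linear_combination (-σ z) * h1

theorem IsRate.isProfile_of_frontMap_eq_zero (hR : IsRate R m M) {μ c : ℝ} {σ k : PeriodMap}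
    (h : frontMap hR.primitive (μ, c, σ, k) = 0) (hk : ∀ z, 0 < k z) :
    IsProfile R μ c σ.ext where
  continuous := σ.continuous_ext
  pos t := (sqrt_eq_of_frontMap_eq_zero h hk t).2.1
  eqn z hz := by
    simp_rw [fun t => (sqrt_eq_of_frontMap_eq_zero h hk t).1]
    rw [intervalIntegral.integral_sub (hR.intervalIntegrable _ _)
      ((PeriodMap.continuous_ext _).const_mul c |>.intervalIntegrable _ _),
      intervalIntegral.integral_const_mul, ext_apply _ hz, show σ.ext 1 = σ 1 from σ.ext_coe 1]
    have h1 := DFunLike.congr_fun (congrArg (fun x => x.1) h) ⟨z, hz⟩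
    have h2 : hR.primitive ⟨z, hz⟩ = ∫ t in (0 : ℝ)..z, R t := rfl
    simp only [frontMap, ContinuousMap.add_apply, ContinuousMap.sub_apply, endConst_apply, h2,
      ContinuousMap.smul_apply, smul_eq_mul, primitive_apply, Prod.fst_zero,
      ContinuousMap.zero_apply] at h1
    linarith
  mean := by
    simp_rw [fun t => (sqrt_eq_of_frontMap_eq_zero h hk t).2.2]
    exact mean_mul_eq_zero h

theorem IsRate.frontMap_eq_zero_of_isProfile (hR : IsRate R m M) {μ c : ℝ} {σ : ℝ → ℝ}
    (h : IsProfile R μ c σ) :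
    ∃ s k : PeriodMap, frontMap hR.primitive (μ, c, s, k) = 0 ∧ (∀ z, 0 < k z) ∧
      ∀ z, s z = σ z := by
  have hc := h.continuous
  let s : PeriodMap := ⟨fun z => σ z, hc.comp continuous_subtype_val⟩
  let k : PeriodMap := ⟨fun z => (√(1 - μ ^ 2 * σ z ^ 2))⁻¹,
    (h.continuous_sqrt.comp continuous_subtype_val).inv₀ fun z => (h.sqrt_pos z).ne'⟩
  have hs : ∀ z, s z = σ z := fun _ => rfl
  have hk : ∀ z, k z = (√(1 - μ ^ 2 * σ z ^ 2))⁻¹ := fun _ => rfl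
  have hkz : ∀ z, 0 < k z := fun z => inv_pos.2 (h.sqrt_pos z)
  have hsq : ∀ z, √(1 - μ ^ 2 * σ z ^ 2) ^ 2 = 1 - μ ^ 2 * σ z ^ 2 := fun z =>
    Real.sq_sqrt (h.pos z).le
  have e : ∀ z ∈ Set.Icc (0 : ℝ) 1,
      (k * (1 - μ ^ 2 • s ^ 2)).ext z = √(1 - μ ^ 2 * σ z ^ 2) := by
    intro z hz
    have h1 := h.sqrt_pos z
    rw [ext_apply _ hz]
    simp only [ContinuousMap.mul_apply, ContinuousMap.sub_apply, ContinuousMap.one_apply,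
      ContinuousMap.smul_apply, ContinuousMap.pow_apply, smul_eq_mul, hs, hk]
    rw [inv_mul_eq_iff_eq_mul₀ h1.ne', ← sq, hsq]
  refine ⟨s, k, Prod.ext ?_ (Prod.ext ?_ ?_), hkz, hs⟩
  · ext z
    have h1 := h.eqn z z.2
    have h2 : hR.primitive z = ∫ t in (0 : ℝ)..z, R t := rfl
    have h3 : ∫ t in (0 : ℝ)..z, (k * (1 - μ ^ 2 • s ^ 2)).ext t =
        ∫ t in (0 : ℝ)..z, √(1 - μ ^ 2 * σ t ^ 2) := by
      refine intervalIntegral.integral_congr fun t ht => ?_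
      rw [Set.uIcc_of_le z.2.1] at ht
      exact e t ⟨ht.1, ht.2.trans z.2.2⟩
    rw [intervalIntegral.integral_sub (hR.intervalIntegrable _ _)
      ((h.continuous_sqrt.const_mul c).intervalIntegrable _ _),
      intervalIntegral.integral_const_mul] at h1
    simp only [frontMap, ContinuousMap.add_apply, ContinuousMap.sub_apply, endConst_apply, h2,
      ContinuousMap.smul_apply, smul_eq_mul, primitive_apply, Prod.fst_zero,
      ContinuousMap.zero_apply, h3, hs]
    simp only [Set.Icc.coe_one]
    linarith
  · refine Eq.trans ?_ h.mean
    refine intervalIntegral.integral_congr fun t ht => ?_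
    replace ht : t ∈ Set.Icc (0 : ℝ) 1 := by rwa [← Set.uIcc_of_le zero_le_one]
    simp only [ext_apply _ ht]
    rfl
  · ext z
    have h1 := h.sqrt_pos z
    have h2 := hsq z
    simp only [frontMap, ContinuousMap.mul_apply, ContinuousMap.sub_apply,
      ContinuousMap.one_apply, ContinuousMap.smul_apply, ContinuousMap.pow_apply, smul_eq_mul,
      hs, hk, Prod.snd_zero, ContinuousMap.zero_apply]
    rw [inv_pow, h2, inv_mul_cancel₀ (h.pos z).ne', sub_self]

end Profile

/-! ### Existence of profiles by the continuity method -/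

theorem PeriodMap.isCompact_setOf_lipschitz (M : ℝ) :
    IsCompact {f : PeriodMap | (∀ z, |f z| ≤ M) ∧ ∀ x y, |f x - f y| ≤ M * dist x y} := by
  refine ArzelaAscoli.isCompact_of_equicontinuous _ ?_ ?_
  · have e : ContinuousMap.toFun ''
        {f : PeriodMap | (∀ z, |f z| ≤ M) ∧ ∀ x y, |f x - f y| ≤ M * dist x y} =
        (Set.univ.pi fun _ => Set.Icc (-M) M) ∩
          ⋂ x : Set.Icc (0 : ℝ) 1, ⋂ y : Set.Icc (0 : ℝ) 1,
            {f : Set.Icc (0 : ℝ) 1 → ℝ | |f x - f y| ≤ M * dist x y} := by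
      ext f
      simp only [Set.mem_image, Set.mem_ofPred_eq, Set.mem_inter_iff, Set.mem_pi, Set.mem_univ,
        true_imp_iff, Set.mem_Icc, Set.mem_iInter]
      constructor
      · rintro ⟨g, ⟨h1, h2⟩, rfl⟩
        exact ⟨fun z => abs_le.1 (h1 z), h2⟩
      · rintro ⟨h1, h2⟩
        have hf : LipschitzWith M.toNNReal f := LipschitzWith.of_dist_le_mul fun x y => by
          rw [Real.dist_eq]
          exact (h2 x y).trans
            (mul_le_mul_of_nonneg_right (Real.le_coe_toNNReal M) dist_nonneg)
        exact ⟨⟨f, hf.continuous⟩, ⟨fun z => abs_le.2 (h1 z), h2⟩, rfl⟩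
    rw [e]
    refine (isCompact_univ_pi fun _ => isCompact_Icc).inter_right ?_
    refine isClosed_iInter fun x => isClosed_iInter fun y => ?_
    exact isClosed_le (by fun_prop) continuous_const
  · refine UniformEquicontinuous.equicontinuous ?_
    refine LipschitzWith.uniformEquicontinuous _ M.toNNReal fun f =>
      LipschitzWith.of_dist_le_mul fun x y => ?_
    rw [Real.dist_eq]
    exact (f.2.2 x y).trans (mul_le_mul_of_nonneg_right (Real.le_coe_toNNReal M) dist_nonneg)

section Existence
variable {R : ℝ → ℝ} {m M : ℝ}

/-- The profile for `μ = 0` is the primitive of `R - c`, with zero mean. -/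
theorem IsRate.exists_isProfile_zero (hR : IsRate R m M) : ∃ c σ, IsProfile R 0 c σ := by
  set c := ∫ t in (0 : ℝ)..1, R t with hc
  set G : ℝ → ℝ := fun z => (∫ t in (0 : ℝ)..z, R t) - c * z with hG
  have hGc : Continuous G := hR.continuous_primitive.sub (continuous_const.mul continuous_id)
  set A := ∫ t in (0 : ℝ)..1, G t with hA
  have hG1 : G 1 = 0 := by simp [hG, hc]
  refine ⟨c, fun z => G z - A, hGc.sub continuous_const, fun z => by simp, fun z _ => ?_, ?_⟩
  · rw [hG1]
    have : ∫ t in (0 : ℝ)..z, (R t - c * √(1 - 0 ^ 2 * (G t - A) ^ 2)) = G z := by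
      simp only [ne_eq, OfNat.ofNat_ne_zero, not_false_eq_true, zero_pow, zero_mul, sub_zero,
        Real.sqrt_one, mul_one]
      rw [intervalIntegral.integral_sub (hR.intervalIntegrable _ _) intervalIntegrable_const]
      simp [hG, mul_comm]
    rw [this]; ring
  · simp only [ne_eq, OfNat.ofNat_ne_zero, not_false_eq_true, zero_pow, zero_mul, sub_zero,
      Real.sqrt_one, div_one]
    rw [intervalIntegral.integral_sub (hGc.intervalIntegrable _ _) intervalIntegrable_const]
    simp [hA]

theorem IsRate.isOpen_setOf_exists_isProfile (hR : IsRate R m M) :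
    IsOpen {μ : ℝ | ∃ c σ, IsProfile R μ c σ} := by
  rw [isOpen_iff_mem_nhds]
  rintro μ ⟨c, σ, h⟩
  obtain ⟨s, k, h0, hk, -⟩ := hR.frontMap_eq_zero_of_isProfile h
  obtain ⟨φ, -, -, hφ⟩ := exists_branch h0 hk
  filter_upwards [hφ] with ν hν
  exact ⟨_, _, hR.isProfile_of_frontMap_eq_zero hν.1 hν.2⟩

/-- The a priori bounds place `(c, σ)` in a compact set `K` independent of `μ`, so the set is the
projection of a closed subset of `ℝ × K` along a compact factor. -/
theorem IsRate.isClosed_setOf_exists_isProfile (hR : IsRate R m M) :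
    IsClosed {μ : ℝ | ∃ c σ, IsProfile R μ c σ} := by
  set d := m / (M + 1) with hd
  have hd0 : 0 < d :=
    div_pos hR.pos (by linarith [hR.pos, (hR.ge 0).trans (hR.le 0)])
  set K : Set (ℝ × PeriodMap) := Set.Icc m M ×ˢ
    {f : PeriodMap | (∀ z, |f z| ≤ M) ∧ ∀ x y, |f x - f y| ≤ M * dist x y} with hK
  have hKc : IsCompact K := isCompact_Icc.prod (isCompact_setOf_lipschitz M)
  have : CompactSpace K := isCompact_iff_compactSpace.1 hKc
  set w : ℝ × K → ℝ → ℝ := fun p t => 1 - p.1 ^ 2 * (p.2 : ℝ × PeriodMap).2.ext t ^ 2 with hw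
  have hext : Continuous fun q : (ℝ × K) × ℝ => (q.1.2 : ℝ × PeriodMap).2.ext q.2 :=
    ext_continuous_uncurry.comp (f := fun q : (ℝ × K) × ℝ => ((q.1.2 : ℝ × PeriodMap).2, q.2))
      (by fun_prop)
  have hwc : Continuous (Function.uncurry w) := by
    have : Continuous fun q : (ℝ × K) × ℝ =>
        1 - q.1.1 ^ 2 * (q.1.2 : ℝ × PeriodMap).2.ext q.2 ^ 2 := by fun_prop
    exact this
  have hwt : ∀ t, Continuous fun p => w p t := fun t =>
    hwc.comp (f := fun p => (p, t)) (by fun_prop)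
  have het : ∀ t, Continuous fun p : ℝ × K => (p.2 : ℝ × PeriodMap).2.ext t := fun t =>
    hext.comp (f := fun p => (p, t)) (by fun_prop)
  -- The truncation `max (d ^ 2) (w p t)` keeps the integrand continuous on all of `ℝ × K`; on `A`
  -- it changes nothing.
  set A : Set (ℝ × K) := (⋂ t : ℝ, {p | d ^ 2 ≤ w p t}) ∩
    ((⋂ z : ℝ, {p | (p.2 : ℝ × PeriodMap).2.ext z = (p.2 : ℝ × PeriodMap).2.ext 1 +
      ((∫ t in (0 : ℝ)..(max 0 (min z 1)), R t) -
        (p.2 : ℝ × PeriodMap).1 * ∫ t in (0 : ℝ)..(max 0 (min z 1)), √(w p t))}) ∩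
    {p | ∫ t in (0 : ℝ)..1, (p.2 : ℝ × PeriodMap).2.ext t / √(max (d ^ 2) (w p t)) = 0}) with hA
  have hAc : IsClosed A := by
    refine (isClosed_iInter fun t => isClosed_le continuous_const (hwt t)).inter
      ((isClosed_iInter fun z => isClosed_eq (het z) ?_).inter (isClosed_eq ?_ continuous_const))
    · refine (het 1).add (continuous_const.sub (Continuous.mul (by fun_prop) ?_))
      refine intervalIntegral.continuous_parametric_intervalIntegral_of_continuous' ?_ _ _
      exact Real.continuous_sqrt.comp hwc
    · refine intervalIntegral.continuous_parametric_intervalIntegral_of_continuous' ?_ _ _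
      refine hext.div (Real.continuous_sqrt.comp (continuous_const.max hwc)) fun q => ?_
      exact (Real.sqrt_pos.2 (lt_max_of_lt_left (by positivity))).ne'
  have e : {μ : ℝ | ∃ c σ, IsProfile R μ c σ} = Prod.fst '' A := by
    ext μ
    constructor
    · rintro ⟨c, σ, h⟩
      obtain ⟨s, k, h0, hk, -⟩ := hR.frontMap_eq_zero_of_isProfile h
      have h1 := hR.isProfile_of_frontMap_eq_zero h0 hk
      have hs : (c, s) ∈ K := by
        refine ⟨⟨h1.le_speed hR, h1.speed_le hR⟩, fun z => ?_, fun x y => ?_⟩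
        · rw [← s.ext_coe z]
          exact h1.abs_le hR z.2
        · rw [← s.ext_coe x, ← s.ext_coe y]
          exact h1.dist_le hR x.2 y.2
      have hwd : ∀ t, d ^ 2 ≤ w (μ, ⟨(c, s), hs⟩) t := fun t => by
        have := h1.le_one_sub hR (Set.projIcc (0 : ℝ) 1 zero_le_one t).2
        rwa [ext_coe] at this
      refine ⟨(μ, ⟨(c, s), hs⟩), ⟨Set.mem_iInter.2 hwd, Set.mem_iInter.2 fun z => ?_, ?_⟩, rfl⟩
      · set z' := max 0 (min z 1) with hz'
        have hz1 : z' ∈ Set.Icc (0 : ℝ) 1 :=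
          ⟨le_max_left _ _, max_le zero_le_one (min_le_right _ _)⟩
        have h2 := h1.eqn z' hz1
        rw [intervalIntegral.integral_sub (hR.intervalIntegrable _ _)
          ((h1.continuous_sqrt.const_mul c).intervalIntegrable _ _),
          intervalIntegral.integral_const_mul] at h2
        have h3 : s.ext z = s.ext z' := by
          rw [ext_apply _ hz1, ext_eq]
          congr 1
          ext
          change max 0 (min 1 z) = max 0 (min z 1)
          rw [min_comm]
        exact h3.trans h2
      · refine Eq.trans ?_ h1.mean
        refine intervalIntegral.integral_congr fun t _ => ?_
        simp only
        rw [max_eq_right (hwd t)]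
    · rintro ⟨⟨ν, ⟨⟨c, s⟩, hs⟩⟩, ⟨h1, h2, h3⟩, rfl⟩
      rw [Set.mem_iInter] at h1 h2
      have hpos : ∀ z, 0 < 1 - ν ^ 2 * s.ext z ^ 2 := fun z =>
        lt_of_lt_of_le (by positivity) (h1 z)
      have hsc := s.continuous_ext
      refine ⟨c, s.ext, hsc, hpos, fun z hz => ?_, ?_⟩
      · have h4 := h2 z
        have h5 : max 0 (min z 1) = z := by rw [min_eq_left hz.2, max_eq_right hz.1]
        rw [Set.mem_ofPred_eq, h5] at h4
        rw [intervalIntegral.integral_sub (hR.intervalIntegrable _ _)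
          (Continuous.intervalIntegrable (by fun_prop) _ _),
          intervalIntegral.integral_const_mul]
        exact h4
      · refine Eq.trans ?_ h3
        refine intervalIntegral.integral_congr fun t _ => ?_
        have := h1 t
        simp only
        rw [max_eq_right this]
  rw [e]
  exact isClosedMap_fst_of_compactSpace _ hAc

theorem IsRate.exists_isProfile (hR : IsRate R m M) (μ : ℝ) : ∃ c σ, IsProfile R μ c σ := by
  have h : {μ : ℝ | ∃ c σ, IsProfile R μ c σ} = Set.univ :=
    IsClopen.eq_univ ⟨hR.isClosed_setOf_exists_isProfile, hR.isOpen_setOf_exists_isProfile⟩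
      ⟨0, hR.exists_isProfile_zero⟩
  exact (Set.eq_univ_iff_forall.1 h) μ

/-! ### Smoothness and monotonicity of the speed in `μ` -/

/-- Multiply `η' = θ + β η - γ w` by `exp (-B)`, `B = ∫ β`. As `B 0 = B 1 = 0` and `η 0 = η 1`,
integration leaves `∫ exp (-B) θ = γ ∫ exp (-B) w`. -/
theorem PeriodMap.pos_of_linearized {β w θ η : PeriodMap} {γ : ℝ} (hw : ∀ z, 0 < w z)
    (hθ : ∀ z, 0 ≤ θ z) (hβ : PeriodMap.mean β = 0)
    (h : η - endConst η + γ • primitive w - primitive (β * η) = primitive θ) :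
    0 ≤ γ ∧ ((∃ z, 0 < θ z) → 0 < γ) := by
  set F : PeriodMap := θ + β * η - γ • w with hF
  set B : ℝ → ℝ := fun z => ∫ t in (0 : ℝ)..z, β.ext t with hB
  have hBd : ∀ z, HasDerivAt B (β.ext z) z := fun z => β.continuous_ext.hasDerivAt_integral 0 z
  have hBc : Continuous B := continuous_iff_continuousAt.2 fun z => (hBd z).continuousAt
  have hB1 : B 1 = 0 := hβ
  have hB0 : B 0 = 0 := by simp [hB]
  have hβc := β.continuous_ext
  have hwc := w.continuous_ext
  have hθc := θ.continuous_ext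
  have hFc := F.continuous_ext
  set Y : ℝ → ℝ := fun z => η 1 + ∫ t in (0 : ℝ)..z, F.ext t with hY
  have hYd : ∀ z, HasDerivAt Y (F.ext z) z := fun z =>
    (hFc.hasDerivAt_integral 0 z).const_add _
  have hYc : Continuous Y := continuous_iff_continuousAt.2 fun z => (hYd z).continuousAt
  have hYη : ∀ z (hz : z ∈ Set.Icc (0 : ℝ) 1), Y z = η.ext z := fun z hz => by
    have h1 := DFunLike.congr_fun h ⟨z, hz⟩
    have h2 : ∫ t in (0 : ℝ)..z, F.ext t = primitive F ⟨z, hz⟩ := rfl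
    simp only [ContinuousMap.sub_apply, ContinuousMap.add_apply, ContinuousMap.smul_apply,
      smul_eq_mul, endConst_apply] at h1
    have h3 : primitive F ⟨z, hz⟩ =
        primitive θ ⟨z, hz⟩ + primitive (β * η) ⟨z, hz⟩ - γ * primitive w ⟨z, hz⟩ := by
      simp only [hF, map_sub, map_add, map_smul, ContinuousMap.sub_apply,
        ContinuousMap.add_apply, ContinuousMap.smul_apply, smul_eq_mul]
    simp only [hY, h2, h3, ext_apply _ hz]
    linarith
  have h01 : Y 0 = Y 1 := by
    rw [hYη 1 (by simp), show η.ext 1 = η 1 from η.ext_coe 1]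
    simp [hY]
  have hd : ∀ z, HasDerivAt (fun z => Real.exp (-B z) * Y z)
      (Real.exp (-B z) * (F.ext z - β.ext z * Y z)) z := fun z => by
    have := (hBd z).neg.exp.mul (hYd z)
    convert! this using 1
    simp only [Pi.neg_apply]
    ring
  have hint := intervalIntegral.integral_eq_sub_of_hasDerivAt (a := 0) (b := 1)
    (fun t _ => hd t) (Continuous.intervalIntegrable (by fun_prop) _ _)
  rw [hB0, hB1, h01, sub_self] at hint
  have e : ∫ t in (0 : ℝ)..1, Real.exp (-B t) * (F.ext t - β.ext t * Y t) =
      (∫ t in (0 : ℝ)..1, Real.exp (-B t) * θ.ext t) -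
        γ * ∫ t in (0 : ℝ)..1, Real.exp (-B t) * w.ext t := by
    rw [← intervalIntegral.integral_const_mul, ← intervalIntegral.integral_sub
      (Continuous.intervalIntegrable (by fun_prop) _ _)
      (Continuous.intervalIntegrable (by fun_prop) _ _)]
    refine intervalIntegral.integral_congr fun t ht => ?_
    rw [Set.uIcc_of_le zero_le_one] at ht
    have h3 : F.ext t = θ.ext t + β.ext t * η.ext t - γ * w.ext t := rfl
    simp only [h3, hYη t ht]
    ring
  rw [e, sub_eq_zero] at hint
  have hW : 0 < ∫ t in (0 : ℝ)..1, Real.exp (-B t) * w.ext t :=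
    intervalIntegral.intervalIntegral_pos_of_pos
      (Continuous.intervalIntegrable (by fun_prop) _ _)
      (fun t => mul_pos (Real.exp_pos _) (hw _)) one_pos
  constructor
  · have : 0 ≤ ∫ t in (0 : ℝ)..1, Real.exp (-B t) * θ.ext t :=
      intervalIntegral.integral_nonneg zero_le_one
        fun t _ => mul_nonneg (Real.exp_pos _).le (hθ _)
    rw [hint] at this
    exact nonneg_of_mul_nonneg_left this hW
  · rintro ⟨z, hz⟩
    have : 0 < ∫ t in (0 : ℝ)..1, Real.exp (-B t) * θ.ext t :=
      intervalIntegral.integral_pos one_pos (Continuous.continuousOn (by fun_prop))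
        (fun t _ => mul_nonneg (Real.exp_pos _).le (hθ _))
        ⟨z, z.2, mul_pos (Real.exp_pos _) (by rwa [ext_coe])⟩
    rw [hint] at this
    exact pos_of_mul_pos_left this hW.le

/-- By uniqueness `C` coincides near `μ` with the speed along the smooth branch. Eliminating `κ`
from the differentiated equation leaves the linearized problem with source `θ = c μ k σ² ≥ 0`. -/
theorem IsRate.contDiffAt_and_deriv (hR : IsRate R m M) {C : ℝ → ℝ} {S : ℝ → ℝ → ℝ}
    (hC : ∀ μ, IsProfile R μ (C μ) (S μ)) (μ : ℝ) :
    ContDiffAt ℝ ∞ C μ ∧ (0 < μ → 0 ≤ deriv C μ ∧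
      ((∃ z ∈ Set.Icc (0 : ℝ) 1, S μ z ≠ 0) → 0 < deriv C μ)) := by
  obtain ⟨s, k, h0, hk, hs⟩ := hR.frontMap_eq_zero_of_isProfile (hC μ)
  obtain ⟨φ, hφs, hφ0, hφ⟩ := exists_branch h0 hk
  have heq : C =ᶠ[𝓝 μ] fun ν => (φ ν).1 := by
    filter_upwards [hφ] with ν hν
    exact ((hC ν).unique (hR.isProfile_of_frontMap_eq_zero hν.1 hν.2) hR).1
  have hCs : ContDiffAt ℝ ∞ C μ := (contDiffAt_fst.comp μ hφs).congr_of_eventuallyEq heq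
  refine ⟨hCs, fun hμ => ?_⟩
  obtain ⟨⟨γ, η, κ⟩, hd⟩ : ∃ v, HasDerivAt φ v μ :=
    ⟨_, (hφs.differentiableAt (by simp)).hasDerivAt⟩
  have hd1 : HasDerivAt (fun ν => (φ ν).1) γ μ := hd.fst
  have hCd : deriv C μ = γ := by
    rw [heq.deriv_eq]
    exact hd1.deriv
  have hF := hasDerivAt_frontMap hR.primitive (hasDerivAt_id μ) hd1 hd.snd.fst hd.snd.snd
  have hF0 : HasDerivAt (fun ν => frontMap hR.primitive (id ν, (φ ν).1, (φ ν).2.1, (φ ν).2.2))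
      0 μ := (hasDerivAt_const μ 0).congr_of_eventuallyEq (hφ.mono fun ν hν => hν.1)
  have hu := hF.unique hF0
  simp only [hφ0, id, mul_one] at hu
  set c := C μ
  set x : PeriodMap := 1 - μ ^ 2 • s ^ 2 with hx
  have hkx' : ∀ z, k z ^ 2 * x z = 1 := fun z => DFunLike.congr_fun (sq_mul_eq_one h0) z
  rw [Prod.mk_eq_zero, Prod.mk_eq_zero] at hu
  obtain ⟨h1, -, h3⟩ := hu
  have hκ : κ = μ • (k ^ 3 * s ^ 2) + μ ^ 2 • (k ^ 3 * s * η) := by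
    ext z
    have e3 := DFunLike.congr_fun h3 z
    have := hkx' z
    simp at e3 ⊢
    linear_combination (k z / 2) * e3 - κ z * this
  set β : PeriodMap := (c * μ ^ 2) • (s * k) with hβ
  have hβ0 : PeriodMap.mean β = 0 := by rw [hβ, map_smul, mean_mul_eq_zero h0, smul_zero]
  set θ : PeriodMap := (c * μ) • (k * s ^ 2) with hθ
  have e1 : c • (κ * x - k * ((2 * μ) • s ^ 2 + (2 * μ ^ 2) • (s * η))) = -(θ + β * η) := by
    rw [hκ]
    ext z
    have := hkx' z
    simp [hβ, hθ]
    linear_combination (c * μ * k z * s z ^ 2 + c * μ ^ 2 * k z * s z * η z) * this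
  rw [← map_smul PeriodMap.primitive c, e1, map_neg, map_add] at h1
  have hc : 0 < c := hR.pos.trans_le ((hC μ).le_speed hR)
  have hlin : η - endConst η + γ • PeriodMap.primitive (k * x) - PeriodMap.primitive (β * η) =
      PeriodMap.primitive θ := by
    rw [← sub_eq_zero, ← h1]
    abel
  obtain ⟨p1, p2⟩ := PeriodMap.pos_of_linearized (mul_pos_of_frontMap_eq_zero h0 hk)
    (fun z => by
      have := hk z
      simp only [hθ, ContinuousMap.smul_apply, ContinuousMap.mul_apply, ContinuousMap.pow_apply,
        smul_eq_mul]
      positivity) hβ0 hlin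
  rw [hCd]
  refine ⟨p1, ?_⟩
  rintro ⟨z, hz, hne⟩
  refine p2 ⟨⟨z, hz⟩, ?_⟩
  have h5 := hk ⟨z, hz⟩
  have h6 : 0 < s ⟨z, hz⟩ ^ 2 := by rw [hs]; positivity
  simp only [hθ, ContinuousMap.smul_apply, ContinuousMap.mul_apply, ContinuousMap.pow_apply,
    smul_eq_mul]
  positivity

end Existence

/-! ### Periodic representatives -/

theorem ae_comp_add_right {p : ℝ → Prop} (h : ∀ᵐ z, p z) (a : ℝ) : ∀ᵐ z, p (z + a) :=
  (measurePreserving_add_right volume a).quasiMeasurePreserving.ae h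

theorem AEPeriodicOne.ae_forall_int {f : ℝ → ℝ} (hf : AEPeriodicOne f) :
    ∀ᵐ z, ∀ n : ℤ, f (z + n) = f z := by
  have h : ∀ᵐ z, ∀ n : ℤ, f (z + n + 1) = f (z + n) :=
    ae_all_iff.2 fun n => ae_comp_add_right hf n
  filter_upwards [h] with z hz n
  induction n using Int.induction_on with
  | zero => simp
  | succ n ih =>
    rw [← ih, ← hz n]
    push_cast
    rw [add_assoc]
  | pred n ih =>
    rw [← ih, ← hz (-(n : ℤ) - 1)] at *
    congr 1
    push_cast
    ring

theorem AEPeriodicOne.congr {f g : ℝ → ℝ} (hf : AEPeriodicOne f) (h : f =ᵐ[volume] g) :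
    AEPeriodicOne g := by
  filter_upwards [hf, h, ae_comp_add_right h 1] with z h1 h2 h3
  rw [← h2, ← h3, h1]

theorem AEPeriodicOne.periodic {f : ℝ → ℝ} (hf : AEPeriodicOne f) (hc : Continuous f) :
    Function.Periodic f 1 := fun z =>
  congrFun (((hc.comp (continuous_id.add continuous_const)).ae_eq_iff_eq volume hc).1 hf) z

theorem IsCombustionRate.isBoundedUnder_le {𝓡 : ℝ → ℝ} (h : IsCombustionRate 𝓡) :
    IsBoundedUnder (· ≤ ·) (ae volume) 𝓡 := by
  refine ⟨(eLpNorm 𝓡 ∞ volume).toReal, ?_⟩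
  rw [eventually_map]
  filter_upwards [ae_le_eLpNormEssSup (f := 𝓡) (μ := volume)] with z hz
  rw [← eLpNorm_exponent_top] at hz
  have := ENNReal.toReal_mono h.memLp.eLpNorm_ne_top hz
  exact (le_abs_self _).trans (by simpa using this)

/-- A rate has an exactly periodic representative with exact bounds. -/
theorem IsCombustionRate.exists_isRate {𝓡 : ℝ → ℝ} (h : IsCombustionRate 𝓡) :
    ∃ (R : ℝ → ℝ) (m : ℝ), IsRate R m (essSup 𝓡 volume) ∧ Function.Periodic R 1 ∧
      R =ᵐ[volume] 𝓡 := by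
  obtain ⟨m, hm, hmR⟩ := h.lower_bound
  set M := essSup 𝓡 volume with hM
  have hRM : ∀ᵐ z, 𝓡 z ≤ M := ae_le_essSup h.isBoundedUnder_le
  have hmM : m ≤ M := by
    obtain ⟨z, h1, h2⟩ := (hmR.and hRM).exists
    exact h1.trans h2
  obtain ⟨g, hg, hgR⟩ := h.memLp.1
  -- Composing with `Int.fract` gives exact periodicity, and truncation gives bounds valid
  -- everywhere. Taking `M` to be the essential supremum makes `c ≤ M` sharp in the limit.
  refine ⟨fun z => max m (min M (g (Int.fract z))), m, ⟨?_, hm, fun z => le_max_left _ _,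
    fun z => max_le hmM (min_le_left _ _)⟩, fun z => ?_, ?_⟩
  · exact measurable_const.max (measurable_const.min (hg.measurable.comp measurable_fract))
  · simp only [Int.fract_add_one]
  · have h1 : ∀ᵐ z, ∀ n : ℤ, 𝓡 (z + n) = g (z + n) :=
      ae_all_iff.2 fun n => ae_comp_add_right hgR n
    filter_upwards [h1, h.periodic.ae_forall_int, hmR, hRM] with z h1 h2 h3 h4
    have e : Int.fract z = z + ((-⌊z⌋ : ℤ) : ℝ) := by
      rw [Int.fract]; push_cast; ring
    rw [e, ← h1, h2, min_eq_right h4, max_eq_right h3]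

theorem IsFrontSolution.congr {R R' : ℝ → ℝ} {lam c : ℝ} {h : ℝ → ℝ}
    (hf : IsFrontSolution R lam c h) (hR : R =ᵐ[volume] R') : IsFrontSolution R' lam c h where
  memLp := hf.memLp
  weak_eq := by
    obtain ⟨hz, h1, h2, h3⟩ := hf.weak_eq
    refine ⟨hz, h1, h2, ?_⟩
    filter_upwards [h3, hR] with z h4 h5
    rw [← h5, h4]
  periodic := hf.periodic
  mean_zero := hf.mean_zero

/-! ### Correspondence between fronts and profiles -/

theorem hasDerivAt_div_sqrt (x : ℝ) :
    HasDerivAt (fun x : ℝ => x / √(1 + x ^ 2)) (1 / ((1 + x ^ 2) * √(1 + x ^ 2))) x := by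
  have h0 : 0 < 1 + x ^ 2 := by positivity
  have h1 := (((hasDerivAt_pow 2 x).const_add 1).sqrt h0.ne')
  have h2 := (hasDerivAt_id x).div h1 (Real.sqrt_pos.2 h0).ne'
  convert! h2 using 1
  have h3 := Real.sqrt_pos.2 h0
  have h4 := Real.sq_sqrt h0.le
  simp only [id, Nat.cast_ofNat]
  field_simp
  rw [h4]
  ring

theorem lipschitzWith_div_sqrt : LipschitzWith 1 fun x : ℝ => x / √(1 + x ^ 2) := by
  refine lipschitzWith_of_nnnorm_deriv_le (fun x => (hasDerivAt_div_sqrt x).differentiableAt)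
    fun x => ?_
  rw [(hasDerivAt_div_sqrt x).deriv, ← NNReal.coe_le_coe, coe_nnnorm, Real.norm_eq_abs]
  have h1 : 1 ≤ √(1 + x ^ 2) := Real.one_le_sqrt.2 (by nlinarith [sq_nonneg x])
  have h2 : 1 ≤ (1 + x ^ 2) * √(1 + x ^ 2) := by nlinarith [sq_nonneg x]
  rw [abs_of_nonneg (by positivity), NNReal.coe_one]
  exact div_le_one_of_le₀ h2 (by positivity)

section Fronts
variable {R : ℝ → ℝ} {m M : ℝ}

theorem one_sub_sq_div_sqrt {lam : ℝ} (hl : 0 < lam) (x : ℝ) :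
    1 - lam⁻¹ ^ 2 * (lam * (x / √(1 + x ^ 2))) ^ 2 = (1 + x ^ 2)⁻¹ := by
  have h0 : 0 < 1 + x ^ 2 := by positivity
  rw [mul_pow, div_pow, Real.sq_sqrt h0.le]
  field_simp
  ring

/-- The continuous representative of a front yields a profile. -/
theorem IsFrontSolution.exists_isProfile {lam c : ℝ} (hl : 0 < lam)
    {h : ℝ → ℝ} (hf : IsFrontSolution R lam c h) :
    ∃ H : ℝ → ℝ, h =ᵐ[volume] H ∧ Function.Periodic H 1 ∧
      IsProfile R lam⁻¹ c fun z => lam * (H z / √(1 + H z ^ 2)) := by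
  obtain ⟨hz, hzm, hzw, hze⟩ := hf.weak_eq
  obtain ⟨H, K, hHK, hhH, hHd⟩ := hzw.exists_lipschitz hf.memLp hzm
  have hHc := hHK.continuous
  have hper : Function.Periodic H 1 := (hf.periodic.congr hhH).periodic hHc
  have e1 : ∀ z, √(1 - lam⁻¹ ^ 2 * (lam * (H z / √(1 + H z ^ 2))) ^ 2) =
      (√(1 + H z ^ 2))⁻¹ := fun z => by
    rw [one_sub_sq_div_sqrt hl, Real.sqrt_inv]
  have hs0 : ∀ z, 0 < √(1 + H z ^ 2) := fun z => Real.sqrt_pos.2 (by positivity)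
  have hsL : LipschitzWith (1 * K) fun z => H z / √(1 + H z ^ 2) :=
    lipschitzWith_div_sqrt.comp hHK
  refine ⟨H, hhH, hper, ⟨continuous_const.mul hsL.continuous, fun z => ?_, fun z _ => ?_, ?_⟩⟩
  · rw [one_sub_sq_div_sqrt hl]
    positivity
  · have hac : AbsolutelyContinuousOnInterval (fun z => H z / √(1 + H z ^ 2)) 0 z :=
      hsL.lipschitzOnWith.absolutelyContinuousOnInterval
    have h1 := hac.integral_deriv_eq_sub
    have h2 : ∫ t in (0 : ℝ)..z,
        (R t - c * √(1 - lam⁻¹ ^ 2 * (lam * (H t / √(1 + H t ^ 2))) ^ 2)) =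
        ∫ t in (0 : ℝ)..z, lam * deriv (fun z => H z / √(1 + H z ^ 2)) t := by
      -- The derivative of `H / √(1 + H²)` is `H' / (1 + H²)^(3/2)`, so this is the front equation
      -- divided by `√(1 + H²)`.
      refine intervalIntegral.integral_congr_ae ?_
      filter_upwards [hHd, hhH, hze] with t h3 h4 h5 _
      have h6 := (hasDerivAt_div_sqrt (H t)).comp t h3
      have h7 : deriv (fun z => H z / √(1 + H z ^ 2)) t =
        1 / ((1 + H t ^ 2) * √(1 + H t ^ 2)) * hz t := h6.deriv
      rw [e1, h7]
      rw [h4] at h5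
      have h8 := hs0 t
      have h9 : 0 < 1 + H t ^ 2 := by positivity
      field_simp at h5 ⊢
      linear_combination h5
    rw [h2, intervalIntegral.integral_const_mul, h1]
    have h3 : H 1 = H 0 := by simpa using hper 0
    rw [h3]
    ring
  · have h1 : ∫ t in (0 : ℝ)..1, lam * (H t / √(1 + H t ^ 2)) /
        √(1 - lam⁻¹ ^ 2 * (lam * (H t / √(1 + H t ^ 2))) ^ 2) = ∫ t in (0 : ℝ)..1, lam * h t := by
      refine intervalIntegral.integral_congr_ae ?_
      filter_upwards [hhH] with t h4 _
      have h8 := hs0 t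
      rw [e1, h4]
      field_simp
    rw [h1, intervalIntegral.integral_const_mul, hf.mean_zero, mul_zero]

/-- A profile extends to a periodic Lipschitz solution on the line. -/
theorem IsProfile.exists_periodic {μ c : ℝ} {σ : ℝ → ℝ} (h : IsProfile R μ c σ)
    (hR : IsRate R m M) (hper : Function.Periodic R 1) :
    ∃ (G : ℝ → ℝ) (K : NNReal), LipschitzWith K G ∧ Function.Periodic G 1 ∧
      (∀ z ∈ Set.Icc (0 : ℝ) 1, G z = σ z) ∧
      (∀ a b, IntervalIntegrable (fun t => R t - c * √(1 - μ ^ 2 * G t ^ 2)) volume a b ∧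
        ∫ t in a..b, (R t - c * √(1 - μ ^ 2 * G t ^ 2)) = G b - G a) ∧
      ∀ᵐ z, HasDerivAt G (R z - c * √(1 - μ ^ 2 * G z ^ 2)) z := by
  set g : ℝ → ℝ := fun z => σ (Int.fract z) with hg
  have hgσ : ∀ z ∈ Set.Icc (0 : ℝ) 1, g z = σ z := by
    intro z hz
    rcases hz.2.lt_or_eq with h1 | rfl
    · simp only [hg, Int.fract_eq_self.2 ⟨hz.1, h1⟩]
    · simp only [hg, Int.fract_one, h.apply_zero]
  have hgm : Measurable g := h.continuous.measurable.comp measurable_fract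
  have hgp : Function.Periodic g 1 := fun z => by simp only [hg, Int.fract_add_one]
  set f : ℝ → ℝ := fun t => R t - c * √(1 - μ ^ 2 * g t ^ 2) with hf
  have hfm : Measurable f := by
    have := hR.measurable
    fun_prop
  have hfb : ∀ t, ‖f t‖ ≤ M := fun t => by
    have h1 := hR.le t
    have h2 := hR.ge t
    have h3 := h.sqrt_pos (Int.fract t)
    have h4 := IsProfile.sqrt_le_one μ (g t)
    have h5 := h.le_speed hR
    have h6 := h.speed_le hR
    have h7 := hR.pos
    rw [Real.norm_eq_abs, _root_.abs_le]
    simp only [hf]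
    constructor <;> nlinarith
  have hfi : ∀ a b, IntervalIntegrable f volume a b := fun a b =>
    (intervalIntegrable_const (c := M)).mono_fun hfm.aestronglyMeasurable
      (Eventually.of_forall fun t => (hfb t).trans (le_abs_self M))
  have hfl : LocallyIntegrable f :=
    (memLp_top_of_bound hfm.aestronglyMeasurable M (Eventually.of_forall hfb)).locallyIntegrable
      (by simp)
  have hfp : Function.Periodic f 1 := fun z => by simp only [hf, hper z, hgp z]
  set G : ℝ → ℝ := fun z => σ 1 + ∫ t in (0 : ℝ)..z, f t with hG
  have hGσ : ∀ z ∈ Set.Icc (0 : ℝ) 1, G z = σ z := by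
    intro z hz
    rw [h.eqn z hz]
    simp only [hG, add_right_inj]
    refine intervalIntegral.integral_congr fun t ht => ?_
    rw [Set.uIcc_of_le hz.1] at ht
    simp only [hf, hgσ t ⟨ht.1, ht.2.trans hz.2⟩]
  have h01 : ∫ t in (0 : ℝ)..1, f t = 0 := by
    have := hGσ 1 (by simp)
    simp only [hG] at this
    linarith
  have hGp : Function.Periodic G 1 := fun z => by
    simp only [hG, add_right_inj]
    rw [← intervalIntegral.integral_add_adjacent_intervals (hfi 0 z) (hfi z (z + 1)),
      hfp.intervalIntegral_add_eq z 0, zero_add, h01, add_zero]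
  -- The primitive `G` is built from the right-hand side evaluated at the periodic extension `g`;
  -- only their equality makes `G` a solution.
  have hGg : G = g := by
    ext z
    have h1 : G (Int.fract z) = G z := by
      rw [Int.fract]
      have := hGp.sub_zsmul_eq (x := z) ⌊z⌋
      simpa using this
    rw [← h1, hGσ _ ⟨Int.fract_nonneg z, (Int.fract_lt_one z).le⟩]
  have hGl : LipschitzWith M.toNNReal G := by
    refine LipschitzWith.of_dist_le_mul fun x y => ?_
    rw [dist_eq_norm, hG, add_sub_add_left_eq_sub,
      intervalIntegral.integral_interval_sub_left (hfi _ _) (hfi _ _), Real.dist_eq]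
    refine intervalIntegral.norm_integral_le_of_norm_le_const fun t _ => ?_
    exact (hfb t).trans (Real.le_coe_toNNReal M)
  have hGd : ∀ᵐ z, HasDerivAt G (f z) z := by
    filter_upwards [_root_.LocallyIntegrable.ae_hasDerivAt_integral hfl] with z hz
    exact (hz 0).const_add _
  have hff : f = fun t => R t - c * √(1 - μ ^ 2 * G t ^ 2) := by rw [hGg]
  refine ⟨G, M.toNNReal, hGl, hGp, hGσ, fun a b => ?_, ?_⟩
  · rw [← hff]
    refine ⟨hfi a b, ?_⟩
    simp only [hG]
    rw [add_sub_add_left_eq_sub,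
      intervalIntegral.integral_interval_sub_left (hfi _ _) (hfi _ _)]
  · filter_upwards [hGd] with z hz
    rwa [hff] at hz

theorem hasDerivAt_slope {μ x : ℝ} (hx : 0 < 1 - μ ^ 2 * x ^ 2) :
    HasDerivAt (fun x => μ * x / √(1 - μ ^ 2 * x ^ 2))
      (μ / ((1 - μ ^ 2 * x ^ 2) * √(1 - μ ^ 2 * x ^ 2))) x := by
  have h1 := ((((hasDerivAt_pow 2 x).const_mul (μ ^ 2)).const_sub 1).sqrt hx.ne')
  have h2 := ((hasDerivAt_id x).const_mul μ).div h1 (Real.sqrt_pos.2 hx).ne'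
  convert! h2 using 1
  have h3 := Real.sqrt_pos.2 hx
  have h4 := Real.sq_sqrt hx.le
  simp only [id, Nat.cast_ofNat]
  field_simp
  rw [h4]
  ring

/-- Every profile comes from a front. -/
theorem IsProfile.exists_isFrontSolution {lam c : ℝ} (hl : 0 < lam) {σ : ℝ → ℝ}
    (h : IsProfile R lam⁻¹ c σ) (hR : IsRate R m M) (hper : Function.Periodic R 1) :
    ∃ H, IsFrontSolution R lam c H := by
  obtain ⟨G, K, hGK, hGp, hGσ, -, hGd⟩ := h.exists_periodic hR hper
  set μ := lam⁻¹ with hμ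
  have hμ0 : 0 < μ := inv_pos.2 hl
  set d := m / (M + 1) with hd
  have hm := hR.pos
  have hmM : m ≤ M := (hR.ge 0).trans (hR.le 0)
  have hd0 : 0 < d := div_pos hm (by linarith)
  have hd1 : d < 1 := by rw [hd, div_lt_one (by linarith)]; linarith
  have hGfr : ∀ z, G z = σ (Int.fract z) := fun z => by
    rw [← hGσ _ ⟨Int.fract_nonneg z, (Int.fract_lt_one z).le⟩, Int.fract]
    have := hGp.sub_zsmul_eq (x := z) ⌊z⌋
    simpa using this.symm
  have hGdd : ∀ z, d ^ 2 ≤ 1 - μ ^ 2 * G z ^ 2 := fun z => by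
    rw [hGfr]
    exact h.le_one_sub hR ⟨Int.fract_nonneg z, (Int.fract_lt_one z).le⟩
  have hGpos : ∀ z, 0 < 1 - μ ^ 2 * G z ^ 2 := fun z => lt_of_lt_of_le (by positivity) (hGdd z)
  -- The values of `G` stay in `[-b, b]`, where `1 - μ² x² ≥ d²`; there `q`, which recovers `h` from
  -- `σ`, is `C¹`, hence Lipschitz.
  set b := √(1 - d ^ 2) * lam with hb
  have hb2 : μ ^ 2 * b ^ 2 = 1 - d ^ 2 := by
    rw [hb, mul_pow, Real.sq_sqrt (by nlinarith), hμ]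
    field_simp
  have hb0 : 0 ≤ b := by positivity
  have hmem : ∀ z, G z ∈ Set.Icc (-b) b := fun z => by
    refine _root_.abs_le.1 (abs_le_of_sq_le_sq ?_ hb0)
    have := hGdd z
    have h2 : 0 < μ ^ 2 := by positivity
    nlinarith
  set q : ℝ → ℝ := fun x => μ * x / √(1 - μ ^ 2 * x ^ 2) with hq
  obtain ⟨K', hK'⟩ : ∃ K', LipschitzOnWith K' q (Set.Icc (-b) b) := by
    have hpos : ∀ x ∈ Set.Icc (-b) b, 0 < 1 - μ ^ 2 * x ^ 2 := by
      intro x hx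
      have h1 : x ^ 2 ≤ b ^ 2 := sq_le_sq' hx.1 hx.2
      have h2 : 0 < μ ^ 2 := by positivity
      nlinarith [sq_pos_of_pos hd0]
    have hcd : ContDiffOn ℝ 1 q (Set.Icc (-b) b) := by
      refine ContDiffOn.div (by fun_prop) (ContDiffOn.sqrt (by fun_prop) fun x hx => ?_) ?_
      · exact (hpos x hx).ne'
      · exact fun x hx => (Real.sqrt_pos.2 (hpos x hx)).ne'
    exact hcd.exists_lipschitzOnWith (by decide) (convex_Icc _ _) isCompact_Icc
  set H : ℝ → ℝ := fun z => q (G z) with hH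
  have hHL : LipschitzWith (K' * K) H := by
    rw [← lipschitzOnWith_univ]
    exact hK'.comp (lipschitzOnWith_univ.2 hGK) fun z _ => hmem z
  have hw : ∀ z, 0 < √(1 - μ ^ 2 * G z ^ 2) := fun z => Real.sqrt_pos.2 (hGpos z)
  have hHsq : ∀ z, 1 + H z ^ 2 = (√(1 - μ ^ 2 * G z ^ 2) ^ 2)⁻¹ := fun z => by
    have := hGpos z
    simp only [hH, hq, div_pow, Real.sq_sqrt this.le]
    field_simp
    ring
  have hHsqrt : ∀ z, √(1 + H z ^ 2) = (√(1 - μ ^ 2 * G z ^ 2))⁻¹ := fun z => by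
    rw [hHsq, Real.sqrt_inv, Real.sqrt_sq (hw z).le]
  refine ⟨H, ⟨?_, ⟨deriv H, ?_, hHL.isWeakDeriv (Eventually.of_forall fun _ => rfl), ?_⟩, ?_, ?_⟩⟩
  · refine memLp_top_of_bound hHL.continuous.aestronglyMeasurable d⁻¹
      (Eventually.of_forall fun z => ?_)
    refine abs_le_of_sq_le_sq ?_ (by positivity)
    have h1 := hHsq z
    rw [Real.sq_sqrt (hGpos z).le] at h1
    have h2 : (1 - μ ^ 2 * G z ^ 2)⁻¹ ≤ (d ^ 2)⁻¹ := inv_anti₀ (by positivity) (hGdd z)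
    rw [inv_pow]
    linarith
  · refine memLp_top_of_bound (measurable_deriv H).aestronglyMeasurable (K' * K : NNReal)
      (Eventually.of_forall fun z => norm_deriv_le_of_lipschitz hHL)
  · filter_upwards [hGd] with z hz
    have h1 : deriv H z = _ := ((hasDerivAt_slope (hGpos z)).comp z hz).deriv
    rw [h1, hHsqrt, hHsq]
    have h2 := hw z
    nth_rewrite 2 [← Real.sq_sqrt (hGpos z).le]
    have h3 : lam * μ = 1 := mul_inv_cancel₀ hl.ne'
    set W := √(1 - μ ^ 2 * G z ^ 2)
    field_simp
    linear_combination (-(R z - c * W)) * h3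
  · exact Eventually.of_forall fun z => by simp only [hH, hGp z]
  · have h1 : ∫ t in (0 : ℝ)..1, H t =
        ∫ t in (0 : ℝ)..1, μ * (σ t / √(1 - μ ^ 2 * σ t ^ 2)) := by
      refine intervalIntegral.integral_congr fun t ht => ?_
      rw [Set.uIcc_of_le zero_le_one] at ht
      simp only [hH, hq, hGσ t ht, mul_div_assoc]
    rw [h1, intervalIntegral.integral_const_mul, h.mean, mul_zero]

theorem IsFrontSolution.unique (hR : IsRate R m M) {lam c c' : ℝ} (hl : 0 < lam)
    {h h' : ℝ → ℝ} (hf : IsFrontSolution R lam c h) (hf' : IsFrontSolution R lam c' h') :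
    c = c' ∧ h =ᵐ[volume] h' := by
  obtain ⟨H, e, hp, hH⟩ := hf.exists_isProfile hl
  obtain ⟨H', e', hp', hH'⟩ := hf'.exists_isProfile hl
  obtain ⟨h1, h2⟩ := hH.unique hH' hR
  refine ⟨h1, ?_⟩
  have h3 : ∀ z ∈ Set.Icc (0 : ℝ) 1, H z = H' z := by
    intro z hz
    have h4 := mul_left_cancel₀ hl.ne' (h2 z hz)
    -- The map `y ↦ y / √(1 - y²)` inverts `x ↦ x / √(1 + x²)`, so equal profiles give equal slopes.
    have h5 : ∀ x : ℝ, x = (x / √(1 + x ^ 2)) / √(1 - (x / √(1 + x ^ 2)) ^ 2) := by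
      intro x
      have h6 := one_sub_sq_div_sqrt one_pos x
      have h7 : 0 < √(1 + x ^ 2) := Real.sqrt_pos.2 (by positivity)
      simp only [inv_one, one_pow, one_mul] at h6
      rw [h6, Real.sqrt_inv]
      field_simp
    rw [h5 (H z), h4, ← h5]
  have h4 : H = H' := by
    ext z
    have h5 := hp.sub_zsmul_eq (x := z) ⌊z⌋
    have h6 := hp'.sub_zsmul_eq (x := z) ⌊z⌋
    rw [← h5, ← h6]
    have h7 : z - ⌊z⌋ • (1 : ℝ) = Int.fract z := by rw [Int.fract]; simp
    rw [h7]
    exact h3 _ ⟨Int.fract_nonneg z, (Int.fract_lt_one z).le⟩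
  rw [← h4] at e'
  exact e.trans e'.symm

end Fronts

/-! ### Small `lam` and constant rates -/

section Limits
variable {R : ℝ → ℝ} {m M : ℝ}

/-- The primitive is antitone, and its derivative is `f` almost everywhere. -/
theorem ae_nonpos_of_forall_integral_nonpos {f : ℝ → ℝ} (hf : LocallyIntegrable f)
    (h : ∀ a b, a ≤ b → ∫ t in a..b, f t ≤ 0) : ∀ᵐ z, f z ≤ 0 := by
  have hfi : ∀ a b, IntervalIntegrable f volume a b := fun a b =>
    (hf.integrableOn_isCompact isCompact_uIcc).intervalIntegrable
  have hanti : Antitone fun z => ∫ t in (0 : ℝ)..z, f t := fun a b hab => by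
    have h1 := h a b hab
    rw [← intervalIntegral.integral_interval_sub_left (hfi 0 b) (hfi 0 a)] at h1
    linarith
  filter_upwards [_root_.LocallyIntegrable.ae_hasDerivAt_integral hf] with z hz
  rw [← (hz 0).deriv]
  exact hanti.deriv_nonpos

/-- If the speeds stay below `L` as `lam → 0`, then so does the rate. -/
theorem IsRate.ae_le_of_speed_le (hR : IsRate R m M) (hper : Function.Periodic R 1) {C : ℝ → ℝ}
    {S : ℝ → ℝ → ℝ} (hC : ∀ μ, IsProfile R μ (C μ) (S μ)) {L : ℝ} (hL : ∀ μ, 0 < μ → C μ ≤ L) :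
    ∀ᵐ z, R z ≤ L := by
  have hloc : LocallyIntegrable fun z => R z - L := by
    refine LocallyIntegrable.sub ?_ (locallyIntegrable_const L)
    refine (memLp_top_of_bound hR.measurable.aestronglyMeasurable M
      (Eventually.of_forall fun z => ?_)).locallyIntegrable (by simp)
    rw [Real.norm_eq_abs, abs_of_pos (hR.pos.trans_le (hR.ge z))]
    exact hR.le z
  suffices h : ∀ᵐ z, R z - L ≤ 0 by
    filter_upwards [h] with z hz
    linarith
  refine ae_nonpos_of_forall_integral_nonpos hloc fun a b hab => ?_
  -- Since `c √(1 - μ² G²) ≤ L`, the integral is at most that of `G'`, namely `G b - G a`, and `|G|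
  -- ≤ lam`.
  have key : ∀ lam : ℝ, 0 < lam → ∫ t in a..b, (R t - L) ≤ 2 * lam := by
    intro lam hl
    have hμ : 0 < lam⁻¹ := inv_pos.2 hl
    obtain ⟨G, K, hGK, hGp, hGσ, hGi, -⟩ := (hC lam⁻¹).exists_periodic hR hper
    have hGlt : ∀ z, |G z| ≤ lam := fun z => by
      have h1 : G z = S lam⁻¹ (Int.fract z) := by
        rw [← hGσ _ ⟨Int.fract_nonneg z, (Int.fract_lt_one z).le⟩, Int.fract]
        have := hGp.sub_zsmul_eq (x := z) ⌊z⌋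
        simpa using this.symm
      have h2 := (hC lam⁻¹).pos (Int.fract z)
      rw [← h1] at h2
      refine abs_le_of_sq_le_sq ?_ hl.le
      rw [inv_pow, inv_mul_eq_div, sub_pos, div_lt_one (by positivity)] at h2
      exact h2.le
    have h3 : ∫ t in a..b, (R t - L) ≤
        ∫ t in a..b, (R t - C lam⁻¹ * √(1 - lam⁻¹ ^ 2 * G t ^ 2)) := by
      refine intervalIntegral.integral_mono_on hab
        ((hR.intervalIntegrable a b).sub intervalIntegrable_const) (hGi a b).1 fun t _ => ?_
      have h4 := IsProfile.sqrt_le_one lam⁻¹ (G t)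
      have h5 := (hC lam⁻¹).le_speed hR
      have h6 := hL _ hμ
      have h7 := hR.pos
      nlinarith [Real.sqrt_nonneg (1 - lam⁻¹ ^ 2 * G t ^ 2)]
    rw [(hGi a b).2] at h3
    have h8 := abs_le.1 (hGlt a)
    have h9 := abs_le.1 (hGlt b)
    linarith [h8.1, h9.2]
  refine le_of_forall_pos_le_add fun ε hε => ?_
  have := key (ε / 2) (by positivity)
  linarith

theorem IsProfile.ae_eq_const_of_eq_zero {μ c : ℝ} {σ : ℝ → ℝ} (h : IsProfile R μ c σ)
    (hR : IsRate R m M) (hper : Function.Periodic R 1)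
    (h0 : ∀ z ∈ Set.Icc (0 : ℝ) 1, σ z = 0) : ∀ᵐ z, R z = c := by
  obtain ⟨G, K, -, hGp, hGσ, -, hGd⟩ := h.exists_periodic hR hper
  have hG : G = fun _ => 0 := by
    ext z
    have h1 := hGp.sub_zsmul_eq (x := z) ⌊z⌋
    have h7 : z - ⌊z⌋ • (1 : ℝ) = Int.fract z := by rw [Int.fract]; simp
    have h8 : Int.fract z ∈ Set.Icc (0 : ℝ) 1 := ⟨Int.fract_nonneg z, (Int.fract_lt_one z).le⟩
    rw [← h1, h7, hGσ _ h8, h0 _ h8]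
  filter_upwards [hGd] with z hz
  rw [hG] at hz
  have := hz.unique (hasDerivAt_const z (0 : ℝ))
  simp at this
  linarith

end Limits

/-! ### The main theorem -/

theorem mainTheorem2 (𝓡 : ℝ → ℝ) (h𝓡 : IsCombustionRate 𝓡) :
    ∃ c : ℝ → ℝ,
      (∀ lam : ℝ, 0 < lam → ∃ h : ℝ → ℝ, IsFrontSolution 𝓡 lam (c lam) h ∧
        ∀ (c' : ℝ) (h' : ℝ → ℝ), IsFrontSolution 𝓡 lam c' h' →
          c' = c lam ∧ h' =ᵐ[volume] h) ∧
      ContDiffOn ℝ ∞ c (Set.Ioi 0) ∧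
      AntitoneOn c (Set.Ioi 0) ∧
      ((¬ ∃ k : ℝ, ∀ᵐ z : ℝ, 𝓡 z = k) → ∀ lam : ℝ, 0 < lam → deriv c lam < 0) ∧
      Tendsto c (𝓝[>] 0) (𝓝 (essSup 𝓡 volume)) ∧
      Tendsto c atTop (𝓝 (∫ z in (0 : ℝ)..1, 𝓡 z)) := by
  obtain ⟨R, m, hR, hper, hae⟩ := h𝓡.exists_isRate
  choose C S hC using hR.exists_isProfile
  have hCd := hR.contDiffAt_and_deriv hC
  have hderiv : ∀ lam : ℝ, 0 < lam →
      HasDerivAt (fun l => C l⁻¹) (deriv C lam⁻¹ * -(lam ^ 2)⁻¹) lam := fun lam hl =>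
    (((hCd lam⁻¹).1.differentiableAt (by simp)).hasDerivAt).comp lam (hasDerivAt_inv hl.ne')
  have hanti : AntitoneOn (fun l => C l⁻¹) (Set.Ioi 0) := by
    refine antitoneOn_of_deriv_nonpos (convex_Ioi 0)
      (fun l hl => (hderiv l hl).continuousAt.continuousWithinAt) ?_ ?_
    · rw [interior_Ioi]
      exact fun l hl => (hderiv l hl).differentiableAt.differentiableWithinAt
    · rw [interior_Ioi]
      intro l hl
      rw [(hderiv l hl).deriv]
      have h1 := ((hCd l⁻¹).2 (inv_pos.2 hl)).1
      have h2 : 0 ≤ (l ^ 2)⁻¹ := by positivity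
      nlinarith
  refine ⟨fun l => C l⁻¹, fun lam hl => ?_, ?_, hanti, fun hne lam hl => ?_, ?_, ?_⟩
  · obtain ⟨h, hh⟩ := (hC lam⁻¹).exists_isFrontSolution hl hR hper
    exact ⟨h, hh.congr hae, fun c' h' hf => (hf.congr hae.symm).unique hR hl hh⟩
  · intro l hl
    exact ((hCd l⁻¹).1.comp l (contDiffAt_inv ℝ (ne_of_gt hl))).contDiffWithinAt
  · rw [(hderiv lam hl).deriv]
    have h1 : 0 < deriv C lam⁻¹ := by
      refine ((hCd lam⁻¹).2 (inv_pos.2 hl)).2 ?_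
      by_contra! h0
      refine hne ⟨C lam⁻¹, ?_⟩
      filter_upwards [(hC lam⁻¹).ae_eq_const_of_eq_zero hR hper h0, hae] with z h2 h3
      rw [← h3, h2]
    have h2 : 0 < (lam ^ 2)⁻¹ := by positivity
    nlinarith
  · rw [tendsto_order]
    refine ⟨fun a ha => ?_, fun a ha => Eventually.of_forall fun l =>
      ((hC l⁻¹).speed_le hR).trans_lt ha⟩
    -- One speed above `a` suffices: monotonicity carries it to all smaller `lam`.
    obtain ⟨μ, hμ, hμa⟩ : ∃ μ, 0 < μ ∧ a < C μ := by
      by_contra! hle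
      have h1 := hR.ae_le_of_speed_le hper hC hle
      have h2 : ∀ᵐ z, 𝓡 z ≤ a := by
        filter_upwards [h1, hae] with z h3 h4
        rw [← h4]
        exact h3
      have h3 : essSup 𝓡 volume ≤ a := by
        obtain ⟨m', -, hm'⟩ := h𝓡.lower_bound
        refine essSup_le_of_ae_le a h2 ?_
        exact IsCoboundedUnder.of_frequently_ge (a := m') hm'.frequently
      exact absurd h3 (not_le.2 ha)
    filter_upwards [Ioo_mem_nhdsGT (inv_pos.2 hμ)] with l hl
    have := hanti hl.1 (inv_pos.2 hμ : (0 : ℝ) < μ⁻¹) hl.2.le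
    simp only [inv_inv] at this
    exact hμa.trans_le this
  -- The limit `lam → ∞` is continuity of `C` at `μ = 0`, where the square root is `1` and
  -- periodicity reads `c = ∫ R`.
  · have h1 : C 0 = ∫ z in (0 : ℝ)..1, 𝓡 z := by
      have h2 := (hC 0).mul_integral_sqrt hR
      simp only [ne_eq, OfNat.ofNat_ne_zero, not_false_eq_true, zero_pow, zero_mul, sub_zero,
        Real.sqrt_one, intervalIntegral.integral_const, smul_eq_mul, mul_one] at h2
      rw [h2]
      refine intervalIntegral.integral_congr_ae ?_
      filter_upwards [hae] with z hz _ using hz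
    rw [← h1]
    exact (hCd 0).1.continuousAt.tendsto.comp tendsto_inv_atTop_zero
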